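/- Let $d$ be the dimension, let $(\Omega,\mathcal F,\mathbb P)$ be a probability space, and let $(\tau_y)_{y\in\mathbb R^d}$ be a group of measure-preserving transformations of $\Omega$ which is ergodic: every $E\in\mathcal F$ with $\tau_y(E)=E$ for all $y$ has $\mathbb P(E)\in\{0,1\}$. Write $B_R$ for the open ball of radius $R$ about $0$ in $\mathbb R^d$. We call $H:\mathbb R^d\times\mathbb R^d\times\Omega\to\mathbb R$ an *admissible Hamiltonian* if each $H(p,y,\cdot)$ is measurable and * (stationarity) $H(p,y+z,\omega)=H(p,y,\tau_z\omega)$ for all $p,y,z,\omega$; * (coercivity) $\lim_{|p|\to\infty}\inf_{(y,\omega)\in\mathbb R^d\times\Omega}H(p,y,\omega)=+\infty$; * (local boundedness) for each $R>0$ there is $C=C(R)>0$ with $|H(p,y,\omega)|\le C$ for all $p\in B_R$, $y\in\mathbb R^d$, $\omega\in\Omega$; * (regularity) for each $R>0$ there is $C=C(R)>0$ with $|H(p_1,y_1,\omega)-H(p_2,y_2,\omega)|\le C(|p_1-p_2|+|y_1-y_2|)$ for all $p_1,p_2\in B_R$, $y_1,y_2\in\mathbb R^d$, $\omega\in\Omega$.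 An admissible Hamiltonian $H$ is *convex outside a ball* if there are an admissible Hamiltonian $\tilde H$ with $p\mapsto\tilde H(p,y,\omega)$ convex for all $y,\omega$, and $R>0$, such that $\tilde H(p,y,\omega)=H(p,y,\omega)$ for all $|p|\ge R$ and all $y,\omega$. For an admissible $H$, $p\in\mathbb R^d$, $\delta>0$ and $\omega\in\Omega$, let $v^\delta=v^\delta(\cdot,\omega)$ denote the bounded continuous viscosity solution of $$\delta v^\delta+H(p+Dv^\delta,y,\omega)=0\quad\text{on }\mathbb R^d .$$ **Proposition 9.2.** Suppose that for every admissible Hamiltonian $\hat H$ on $(\Omega,\mathcal F,\mathbb P,\tau)$ which is convex outside a ball there is a set $\Omega_8(\hat H)\subset\Omega$ of full probability such that, for every $\omega\in\Omega_8(\hat H)$ and $p\in\mathbb R^d$, for the solution $\hat v^\delta$ of $\delta\hat v^\delta+\hat H(p+D\hat v^\delta,y,\omega)=0$ on $\mathbb R^d$, the limit $\lim_{\delta\to0^+}-\delta\hat v^\delta(0,\omega)$ exists in $\mathbb R$. Let $H$ be any admissible Hamiltonian. Then the solution $v^\delta$ above exists and is unique for all $p\in\mathbb R^d$, $\delta>0$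 and $\omega\in\Omega$, and there are a set $\Omega_9\subset\Omega$ of full probability and a deterministic function $\overline H:\mathbb R^d\to\mathbb R$, the effective Hamiltonian, such that for every $\omega\in\Omega_9$ and $p\in\mathbb R^d$ $$\overline H(p)=\limsup_{\delta\to0^+}-\delta v^\delta(0,\omega),\qquad\text{and}\qquad \lim_{\delta\to0^+}\ \sup_{x\in B_{R/\delta}}\bigl|\overline H(p)+\delta v^\delta(x,\omega)\bigr|=0\quad\text{for every }R>0 .$$ -/

import Mathlib

open Set Filter Topology MeasureTheory

/-- `ℝᵈ` with its Euclidean norm. -/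
abbrev Space (d : ℕ) : Type := EuclideanSpace ℝ (Fin d)

/-- A group `(τ_y)`, `y ∈ ℝᵈ`, of measure-preserving transformations of `Ω` that is ergodic: every
event that is (strictly) invariant under all the `τ_y` has probability `0` or `1`. -/
structure IsErgodicGroup {d : ℕ} {Ω : Type*} [MeasurableSpace Ω] (P : Measure Ω)
    (τ : Space d → Ω → Ω) : Prop where
  zero : ∀ ω, τ 0 ω = ω
  add : ∀ y z ω, τ (y + z) ω = τ y (τ z ω)
  measurePreserving : ∀ y, MeasurePreserving (τ y) P P
  ergodic : ∀ A : Set Ω, MeasurableSet A → (∀ y, τ y '' A = A) → P A = 0 ∨ P A = 1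

/-- The standing hypotheses on a Hamiltonian `H = H(p, y, ω)`. All bounds are uniform in
`y ∈ ℝᵈ` and `ω ∈ Ω`. -/
structure IsHamiltonian {d : ℕ} {Ω : Type*} [MeasurableSpace Ω]
    (τ : Space d → Ω → Ω) (H : Space d → Space d → Ω → ℝ) : Prop where
  /-- every `H(p, y, ·)` is a random variable -/
  measurable : ∀ p y, Measurable (H p y)
  /-- for each `p`, the process `(y, ω) ↦ H(p, y, ω)` is stationary -/
  stationary : ∀ p y z ω, H p (y + z) ω = H p y (τ z ω)
  /-- `inf_{y, ω} H(p, y, ω) → +∞` as `|p| → ∞` -/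
  coercive : ∀ M : ℝ, ∃ R : ℝ, ∀ p, R ≤ ‖p‖ → ∀ y ω, M ≤ H p y ω
  /-- bounded for bounded `p` -/
  bounded : ∀ R : ℝ, 0 < R → ∃ C : ℝ, 0 < C ∧
    ∀ p ∈ Metric.ball (0 : Space d) R, ∀ y ω, |H p y ω| ≤ C
  /-- Lipschitz continuous in `(p, y)`, locally in `p` -/
  lipschitz : ∀ R : ℝ, 0 < R → ∃ C : ℝ, 0 < C ∧
    ∀ p₁ ∈ Metric.ball (0 : Space d) R, ∀ p₂ ∈ Metric.ball (0 : Space d) R, ∀ y₁ y₂ ω,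
      |H p₁ y₁ ω - H p₂ y₂ ω| ≤ C * (‖p₁ - p₂‖ + ‖y₁ - y₂‖)

/-- The nonconvexity of `H` is localized in `p`: outside some ball of momenta, `H` agrees with a
Hamiltonian that satisfies the standing hypotheses and is convex in `p`. -/
def IsConvexOutsideBall {d : ℕ} {Ω : Type*} [MeasurableSpace Ω]
    (τ : Space d → Ω → Ω) (H : Space d → Space d → Ω → ℝ) : Prop :=
  ∃ Hc : Space d → Space d → Ω → ℝ, IsHamiltonian τ Hc ∧
    (∃ R : ℝ, 0 < R ∧ ∀ p, p ∉ Metric.ball (0 : Space d) R → ∀ y ω, Hc p y ω = H p y ω) ∧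
    ∀ y ω, ConvexOn ℝ univ (fun p => Hc p y ω)

/-- `v` is a bounded, continuous viscosity solution of `δ v + F(p + Dv, y) = 0` on `ℝᵈ`. -/
structure IsMacroscopicSolution {d : ℕ} (F : Space d → Space d → ℝ) (p : Space d) (δ : ℝ)
    (v : Space d → ℝ) : Prop where
  continuous : Continuous v
  bounded : ∃ C : ℝ, ∀ x, |v x| ≤ C
  subsolution : ∀ φ : Space d → ℝ, ContDiff ℝ 2 φ → ∀ x, IsLocalMax (fun z => v z - φ z) x →
    δ * v x + F (p + gradient φ x) x ≤ 0
  supersolution : ∀ φ : Space d → ℝ, ContDiff ℝ 2 φ → ∀ x, IsLocalMin (fun z => v z - φ z) x →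
    0 ≤ δ * v x + F (p + gradient φ x) x

open scoped Classical in
/-- The solution `v^δ(·, ω)` of the approximate macroscopic problem
`δ v + H(p + Dv, y, ω) = 0` on `ℝᵈ` (and `0` if there were none). -/
noncomputable def macroscopicSolution {d : ℕ} {Ω : Type*} (H : Space d → Space d → Ω → ℝ)
    (p : Space d) (δ : ℝ) (ω : Ω) : Space d → ℝ :=
  if h : ∃ v, IsMacroscopicSolution (fun q y => H q y ω) p δ v then h.choose else 0

/-- `H̄(p, ω) = limsup_{δ → 0⁺} -δ v^δ(0, ω)`. -/
noncomputable def randomEffectiveHamiltonian {d : ℕ} {Ω : Type*}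
    (H : Space d → Space d → Ω → ℝ) (p : Space d) (ω : Ω) : ℝ :=
  limsup (fun δ : ℝ => -(δ * macroscopicSolution H p δ ω 0)) (𝓝[>] 0)

/-- The deterministic effective Hamiltonian `H̄(p)`, the almost sure value of `H̄(p, ω)`, given as
the supremum of the levels `α` with `H̄(p, ω) > α` almost surely. -/
noncomputable def effectiveHamiltonian {d : ℕ} {Ω : Type*} [MeasurableSpace Ω] (P : Measure Ω)
    (H : Space d → Space d → Ω → ℝ) (p : Space d) : ℝ :=
  sSup {α : ℝ | ∀ᵐ ω ∂P, α < randomEffectiveHamiltonian H p ω}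

/-! Coercivity bounds the gradient of `v^δ` independently of `δ`: `δ v^δ ≥ -C` by comparison with a
constant, and the equation then excludes slopes beyond a fixed `K` (`IsViscositySub.lipschitz`).
Comparison (`IsViscositySub.le_of_error`) and Perron's method (`perronSup_sub`, `perronSup_super`)
give existence and uniqueness, and with them continuous dependence on the Hamiltonian, on `p` and on
`δ`, measurability in `ω`, and the shift rule `v^δ(x, τ_z ω) = v^δ(x + z, ω)`.

Because of the gradient bound, for bounded `p` the equation only sees a bounded set of momenta.
Outside it `H` can be replaced by a cone without changing `v^δ` (`exists_isConvexOutsideBall`), so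
the hypothesis on Hamiltonians convex outside a ball yields the limit at the origin for `H` itself.
Moving the origin by `z` changes `δ v^δ(0)` by at most `δ K |z|`, so the limit is invariant and, by
ergodicity, a constant `c`.

Convergence at the origin spreads to points at distance of order `1/δ`
(`ae_tendsto_along_direction`). Let `g N` be the supremum over `n ≥ N` of `|v^{1/n}(0)/n + c|`. It
tends to `0` boundedly, so the maximal ergodic theorem for `τ x` makes the averages of `g N` along
the orbit of `ω` small, uniformly in their length (`ae_exists_forall_sum_le`). Hence for every large
`n` some `k` close to `n` has `v^{1/n}(k x)/n` near `-c`, and the Lipschitz bound carries this from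
`k x` to `n x`. Lipschitz estimates in `x`, `p` and `δ` extend the result from countably many
directions, momenta and discounts to all of them. -/

/-- `u` is a viscosity subsolution of `δ u + G(Du, x) = 0`. -/
def IsViscositySub {d : ℕ} (G : Space d → Space d → ℝ) (δ : ℝ) (u : Space d → ℝ) : Prop :=
  ∀ φ : Space d → ℝ, ContDiff ℝ 2 φ → ∀ x, IsLocalMax (fun z => u z - φ z) x →
    δ * u x + G (gradient φ x) x ≤ 0

/-- `v` is a viscosity supersolution of `δ v + G(Dv, x) = 0`. -/
def IsViscositySuper {d : ℕ} (G : Space d → Space d → ℝ) (δ : ℝ) (v : Space d → ℝ) : Prop :=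
  ∀ φ : Space d → ℝ, ContDiff ℝ 2 φ → ∀ x, IsLocalMin (fun z => v z - φ z) x →
    0 ≤ δ * v x + G (gradient φ x) x

/-! ### Gradients of the test functions -/

section gradient

variable {d : ℕ}

theorem HasGradientAt.add' {f g : Space d → ℝ} {f' g' x : Space d} (hf : HasGradientAt f f' x)
    (hg : HasGradientAt g g' x) : HasGradientAt (fun y => f y + g y) (f' + g') x := by
  rw [hasGradientAt_iff_hasFDerivAt] at *
  rw [map_add]
  exact hf.add hg

theorem HasGradientAt.const_mul' {f : Space d → ℝ} {f' x : Space d} (c : ℝ)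
    (hf : HasGradientAt f f' x) : HasGradientAt (fun y => c * f y) (c • f') x := by
  rw [hasGradientAt_iff_hasFDerivAt] at *
  rw [map_smul]
  exact hf.const_mul c

theorem hasGradientAt_norm_sub_sq (a x : Space d) :
    HasGradientAt (fun y => ‖y - a‖ ^ 2) ((2 : ℝ) • (x - a)) x := by
  rw [hasGradientAt_iff_hasFDerivAt]
  have h := ((hasFDerivAt_id x).sub_const a).norm_sq
  refine h.congr_fderiv ?_
  ext y
  simp [two_mul]

theorem hasGradientAt_sqrt_norm_sub_sq (a x : Space d) {s : ℝ} (hs : s ≠ 0) :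
    HasGradientAt (fun y => √(‖y - a‖ ^ 2 + s ^ 2)) ((1 / √(‖x - a‖ ^ 2 + s ^ 2)) • (x - a)) x := by
  have h := (hasGradientAt_norm_sub_sq a x)
  rw [hasGradientAt_iff_hasFDerivAt] at *
  have h2 := (h.add_const (s ^ 2)).sqrt (by positivity)
  refine h2.congr_fderiv ?_
  rw [map_smul, map_smul, smul_smul]
  congr 1
  field_simp

theorem contDiff_norm_sub_sq (a : Space d) : ContDiff ℝ 2 (fun y : Space d => ‖y - a‖ ^ 2) :=
  (contDiff_id.sub contDiff_const).norm_sq ℝ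

theorem contDiff_sqrt_norm_sub_sq (a : Space d) {s : ℝ} (hs : s ≠ 0) :
    ContDiff ℝ 2 (fun y : Space d => √(‖y - a‖ ^ 2 + s ^ 2)) :=
  ((contDiff_norm_sub_sq a).add contDiff_const).sqrt (fun x => by positivity)

end gradient

/-! ### The Lipschitz bound from coercivity -/

/-- A continuous function bounded above by a function that decays at infinity attains its
maximum. -/
theorem exists_max_of_le_sub_mul_norm {E : Type*} [NormedAddCommGroup E] [ProperSpace E]
    {f : E → ℝ} (hf : Continuous f) {M β : ℝ} (hβ : 0 < β) {R₀ : ℝ}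
    (h : ∀ x, R₀ ≤ ‖x‖ → f x ≤ M - β * ‖x‖) : ∃ x, ∀ y, f y ≤ f x := by
  refine hf.exists_forall_ge' (0 : E) ?_
  have h1 := (tendsto_norm_cocompact_atTop (E := E)).eventually_ge_atTop
    (max R₀ ((M - f 0) / β))
  filter_upwards [h1] with x hx
  have h2 : (M - f 0) / β ≤ ‖x‖ := (le_max_right _ _).trans hx
  rw [div_le_iff₀ hβ] at h2
  have := h x ((le_max_left _ _).trans hx)
  linarith [mul_comm β ‖x‖]

/-- A subsolution of a coercive equation is Lipschitz continuous. -/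
theorem IsViscositySub.lipschitz {d : ℕ} {G : Space d → Space d → ℝ} {δ C K M : ℝ}
    (hK : 0 < K) (hcoer : ∀ q x, K ≤ ‖q‖ → C < G q x) {u : Space d → ℝ}
    (hu : IsViscositySub G δ u) (huc : Continuous u) (huM : ∀ x, u x ≤ M)
    (huC : ∀ x, -C ≤ δ * u x) (x y : Space d) : u x - u y ≤ K * ‖x - y‖ := by
  by_contra! hlt
  -- choose `K' > K` with a gap
  obtain ⟨K', hKK', hK'⟩ : ∃ K' > K, K' * ‖x - y‖ < u x - u y := by
    have : Tendsto (fun k : ℝ => k * ‖x - y‖) (𝓝[>] K) (𝓝 (K * ‖x - y‖)) :=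
      ((continuous_id.mul continuous_const).tendsto K).mono_left nhdsWithin_le_nhds
    obtain ⟨k, h1, h2⟩ := ((this.eventually_lt_const hlt).and self_mem_nhdsWithin).exists
    exact ⟨k, h2, h1⟩
  have hK'0 : 0 < K' := hK.trans hKK'
  set γ := u x - u y - K' * ‖x - y‖ with hγ
  have hγ0 : 0 < γ := by linarith
  obtain ⟨r, hr, hru⟩ := Metric.continuousAt_iff.1 (huc.continuousAt (x := y)) (γ / 2) (by positivity)
  -- smallness of the regularization
  obtain ⟨s, hs, hs1, hs2⟩ : ∃ s > 0, K' * s < γ / 2 ∧ K * √(r ^ 2 + s ^ 2) < K' * r := by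
    have t1 : Tendsto (fun s : ℝ => K' * s) (𝓝[>] 0) (𝓝 (K' * 0)) :=
      ((continuous_const.mul continuous_id).tendsto 0).mono_left nhdsWithin_le_nhds
    have t2 : Tendsto (fun s : ℝ => K * √(r ^ 2 + s ^ 2)) (𝓝[>] 0) (𝓝 (K * √(r ^ 2 + 0 ^ 2))) :=
      (Continuous.tendsto (by fun_prop) 0).mono_left nhdsWithin_le_nhds
    have e1 : K' * 0 < γ / 2 := by simpa using hγ0
    have e2 : K * √(r ^ 2 + 0 ^ 2) < K' * r := by
      have : √(r ^ 2 + 0 ^ 2) = r := by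
        rw [zero_pow two_ne_zero, add_zero, Real.sqrt_sq hr.le]
      rw [this]
      exact mul_lt_mul_of_pos_right hKK' hr
    obtain ⟨s, ⟨h1, h2⟩, h3⟩ := (((t1.eventually_lt_const e1).and
      (t2.eventually_lt_const e2)).and self_mem_nhdsWithin).exists
    exact ⟨s, h3, h1, h2⟩
  -- A smoothed cone of slope `K'` with vertex `y`. Its gradient has norm `K' * |z - y| / √(|z - y|²
  -- + s²)`, which by the choice of `s` is at least `K` as soon as `|z - y| ≥ r`.
  set φ : Space d → ℝ := fun z => K' * √(‖z - y‖ ^ 2 + s ^ 2) with hφ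
  have hφc : ContDiff ℝ 2 φ := contDiff_const.mul (contDiff_sqrt_norm_sub_sq y hs.ne')
  have hnorm : ∀ z, ‖z - y‖ ≤ √(‖z - y‖ ^ 2 + s ^ 2) := fun z => by
    apply Real.le_sqrt_of_sq_le; nlinarith
  obtain ⟨z, hz⟩ := exists_max_of_le_sub_mul_norm (f := fun z => u z - φ z)
    (huc.sub hφc.continuous) (M := M + K' * ‖y‖) hK'0 (R₀ := 0) (fun z _ => by
      have h1 := hnorm z
      have h2 : ‖z‖ ≤ ‖z - y‖ + ‖y‖ := by simpa using norm_add_le (z - y) y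
      have h3 : K' * ‖z‖ ≤ K' * (√(‖z - y‖ ^ 2 + s ^ 2) + ‖y‖) := by gcongr; linarith
      simp only [hφ]
      linarith [huM z])
  have hsqrt : √(‖x - y‖ ^ 2 + s ^ 2) ≤ ‖x - y‖ + s := by
    rw [Real.sqrt_le_left (by positivity)]
    nlinarith [norm_nonneg (x - y)]
  -- Within distance `r` of `y` the function `u - φ` is below `u y + γ / 2`, whereas at `x` it
  -- exceeds that value.
  have hzr : r ≤ ‖z - y‖ := by
    by_contra! hlt
    have h1 := hru (x := z) (by rwa [dist_eq_norm])
    rw [Real.dist_eq] at h1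
    have h2 := hz x
    have h3 : 0 ≤ φ z := by positivity
    have h4 : φ x ≤ K' * (‖x - y‖ + s) := by simp only [hφ]; gcongr
    have h5 := (abs_lt.1 h1).2
    nlinarith
  have hgrad := (hasGradientAt_sqrt_norm_sub_sq y z hs.ne').const_mul' K'
  have h1 := hu φ hφc z (Filter.Eventually.of_forall hz)
  rw [hgrad.gradient] at h1
  have hpos : 0 < √(‖z - y‖ ^ 2 + s ^ 2) := by positivity
  have hK2 : K ≤ ‖K' • (1 / √(‖z - y‖ ^ 2 + s ^ 2)) • (z - y)‖ := by
    rw [norm_smul, norm_smul, Real.norm_of_nonneg hK'0.le, Real.norm_of_nonneg (by positivity)]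
    rw [show K' * (1 / √(‖z - y‖ ^ 2 + s ^ 2) * ‖z - y‖) =
      (K' * ‖z - y‖) / √(‖z - y‖ ^ 2 + s ^ 2) by ring, le_div_iff₀ hpos]
    refine (sq_le_sq₀ (by positivity) (by positivity)).1 ?_
    rw [mul_pow, mul_pow, Real.sq_sqrt (by positivity)]
    have h2 : (K * √(r ^ 2 + s ^ 2)) ^ 2 < (K' * r) ^ 2 :=
      pow_lt_pow_left₀ hs2 (by positivity) two_ne_zero
    rw [mul_pow, mul_pow, Real.sq_sqrt (by positivity)] at h2
    have h3 : r ^ 2 ≤ ‖z - y‖ ^ 2 := by gcongr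
    have h4 : K ^ 2 < K' ^ 2 := by gcongr
    nlinarith
  have := hcoer _ z hK2
  linarith [huC z]

/-! ### Comparison by doubling of variables -/

/-- The smooth weight `⟨x⟩ = (1 + |x|²)^{1/2}`. -/
noncomputable def bracket {d : ℕ} (x : Space d) : ℝ := √(‖x - 0‖ ^ 2 + 1 ^ 2)

theorem bracket_pos {d : ℕ} (x : Space d) : 0 < bracket x := by
  unfold bracket; positivity

theorem contDiff_bracket {d : ℕ} : ContDiff ℝ 2 (bracket (d := d)) :=
  contDiff_sqrt_norm_sub_sq 0 one_ne_zero

@[fun_prop]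
theorem continuous_bracket {d : ℕ} : Continuous (bracket (d := d)) := contDiff_bracket.continuous

theorem norm_le_bracket {d : ℕ} (x : Space d) : ‖x‖ ≤ bracket x := by
  unfold bracket
  apply Real.le_sqrt_of_sq_le
  rw [sub_zero]; nlinarith

theorem hasGradientAt_bracket {d : ℕ} (x : Space d) :
    ∃ w : Space d, ‖w‖ ≤ 1 ∧ HasGradientAt bracket w x := by
  refine ⟨_, ?_, hasGradientAt_sqrt_norm_sub_sq 0 x one_ne_zero⟩
  have h := norm_le_bracket x
  unfold bracket at h
  rw [norm_smul, Real.norm_of_nonneg (by positivity), div_mul_eq_mul_div, one_mul]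
  exact div_le_one_of_le₀ (by simpa using h) (by positivity)

theorem bracket_le_add {d : ℕ} (a b : Space d) : bracket a ≤ bracket b + ‖a - b‖ := by
  have h1 : ‖a‖ ≤ ‖b‖ + ‖a - b‖ := by simpa using norm_add_le b (a - b)
  have h3 := norm_le_bracket b
  have h2 : bracket b ^ 2 = ‖b - 0‖ ^ 2 + 1 ^ 2 := Real.sq_sqrt (by positivity)
  have h4 := norm_nonneg (a - b)
  rw [sub_zero] at h2
  rw [bracket, sub_zero, Real.sqrt_le_left (by linarith [bracket_pos b])]
  nlinarith [norm_nonneg a, norm_nonneg b]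

/-- The quadratic term controls `y.1 - y.2` and the weight controls `y.2`, so together they force
linear decay in both variables; penalizing one variable is enough. -/
theorem exists_max_doubling {d : ℕ} {u v : Space d → ℝ} (huc : Continuous u) (hvc : Continuous v)
    {M N β : ℝ} (huM : ∀ x, u x ≤ M) (hvM : ∀ x, -M ≤ v x) (hN0 : 0 < N) (hβ : 0 < β) :
    ∃ z : Space d × Space d, ∀ y : Space d × Space d,
      u y.1 - v y.2 - N * ‖y.1 - y.2‖ ^ 2 - β * bracket y.2 ≤
      u z.1 - v z.2 - N * ‖z.1 - z.2‖ ^ 2 - β * bracket z.2 := by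
  have hm : 0 < min N β / 2 := by positivity
  refine exists_max_of_le_sub_mul_norm (f := fun z : Space d × Space d =>
    u z.1 - v z.2 - N * ‖z.1 - z.2‖ ^ 2 - β * bracket z.2) (by fun_prop)
    (M := 2 * M + N) hm (R₀ := 0) ?_
  rintro ⟨y, z⟩ -
  have h1 : ‖(y, z)‖ ≤ ‖y - z‖ + ‖z‖ := by
    rw [Prod.norm_mk]
    refine max_le ?_ (by linarith [norm_nonneg (y - z)])
    simpa using norm_add_le (y - z) z
  have h2 : β * ‖z‖ ≤ β * bracket z := mul_le_mul_of_nonneg_left (norm_le_bracket z) hβ.le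
  have h3 : min N β / 2 * ‖(y, z)‖ ≤ min N β / 2 * (‖y - z‖ + ‖z‖) := by gcongr
  have h4 : ‖y - z‖ ≤ ‖y - z‖ ^ 2 + 1 := by nlinarith [sq_nonneg (‖y - z‖ - 1)]
  have h5 : N * ‖y - z‖ ≤ N * (‖y - z‖ ^ 2 + 1) := mul_le_mul_of_nonneg_left h4 hN0.le
  have h6 : min N β * ‖y - z‖ ≤ N * ‖y - z‖ := by gcongr; exact min_le_left _ _
  have h7 : min N β * ‖z‖ ≤ β * ‖z‖ := by gcongr; exact min_le_right _ _
  have h8 : 0 ≤ N * ‖y - z‖ := by positivity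
  have h9 : 0 ≤ β * ‖z‖ := by positivity
  have := huM y
  have := hvM z
  simp only
  nlinarith

/-- Comparison of a Lipschitz subsolution and a supersolution of two equations whose Hamiltonians
differ by an error that may grow linearly at infinity. -/
theorem IsViscositySub.le_of_error {d : ℕ} {F₁ F₂ : Space d → Space d → ℝ} {δ K Λ M e β : ℝ}
    (hδ : 0 < δ) (hK : 0 ≤ K) (hΛ : 0 ≤ Λ) (hβ : 0 < β) (hβ1 : β ≤ 1)
    (hlip : ∀ q₁ q₂ x y, ‖q₁‖ ≤ 2 * K + 1 → ‖q₂‖ ≤ 2 * K + 1 →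
      |F₂ q₁ x - F₂ q₂ y| ≤ Λ * (‖q₁ - q₂‖ + ‖x - y‖))
    (herr : ∀ q x, ‖q‖ ≤ 2 * K → F₂ q x - F₁ q x ≤ e + δ * β * bracket x)
    {u v : Space d → ℝ} (hu : IsViscositySub F₁ δ u) (hv : IsViscositySuper F₂ δ v)
    (hvc : Continuous v) (huM : ∀ x, u x ≤ M) (hvM : ∀ x, -M ≤ v x)
    (hulip : ∀ x y, u x - u y ≤ K * ‖x - y‖) (x : Space d) :
    u x - v x ≤ (e + Λ * β) / δ + β * bracket x := by
  have huc : Continuous u := by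
    refine (LipschitzWith.of_le_add_mul K.toNNReal fun x y => ?_).continuous
    rw [Real.coe_toNNReal _ hK, dist_eq_norm]
    linarith [hulip x y]
  by_contra! hlt
  set γ := u x - v x - ((e + Λ * β) / δ + β * bracket x) with hγ
  have hγ0 : 0 < γ := by linarith
  -- the doubling parameter
  obtain ⟨N, hN0, hN⟩ : ∃ N > 0, (Λ + δ * β) * K / N < δ * γ := by
    have t : Tendsto (fun N : ℝ => (Λ + δ * β) * K / N) atTop (𝓝 0) :=
      tendsto_const_nhds.div_atTop tendsto_id
    obtain ⟨N, h1, h2⟩ := ((t.eventually_lt_const (show 0 < δ * γ by positivity)).and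
      (eventually_gt_atTop 0)).exists
    exact ⟨N, h2, h1⟩
  set Φ : Space d × Space d → ℝ := fun z =>
    u z.1 - v z.2 - N * ‖z.1 - z.2‖ ^ 2 - β * bracket z.2 with hΦ
  have hΦc : Continuous Φ := by fun_prop
  obtain ⟨⟨a, b⟩, hab⟩ : ∃ z, ∀ y, Φ y ≤ Φ z := exists_max_doubling huc hvc huM hvM hN0 hβ
  -- Comparison with `(b, b)` and the Lipschitz bound on `u`. It puts the test gradient `q` in the
  -- ball of radius `2 * K`, and its perturbation by the weight in that of radius `2 * K + 1`; hence
  -- the ranges in the hypotheses.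
  have hNab : N * ‖a - b‖ ≤ K := by
    have h1 := hab (b, b)
    simp only [hΦ, sub_self, norm_zero] at h1
    have h2 := hulip a b
    rcases (norm_nonneg (a - b)).eq_or_lt with h0 | h0
    · rw [← h0]; simpa using hK
    · have : N * ‖a - b‖ * ‖a - b‖ ≤ K * ‖a - b‖ := by nlinarith
      exact le_of_mul_le_mul_right this h0
  have hgap : γ + ((e + Λ * β) / δ) ≤ u a - v b - β * bracket b := by
    have h1 := hab (x, x)
    simp only [hΦ, sub_self, norm_zero] at h1
    have : 0 ≤ N * ‖a - b‖ ^ 2 := by positivity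
    nlinarith
  -- the two test functions
  set q : Space d := N • ((2 : ℝ) • (a - b)) with hq
  obtain ⟨w, hwn, hwg⟩ := hasGradientAt_bracket b
  have hsub : δ * u a + F₁ q a ≤ 0 := by
    have hg := (hasGradientAt_norm_sub_sq b a).const_mul' N
    have := hu (fun z => N * ‖z - b‖ ^ 2) (contDiff_const.mul (contDiff_norm_sub_sq b)) a
      (Filter.Eventually.of_forall fun z => by
        have := hab (z, b)
        simp only [hΦ] at this ⊢
        linarith)
    rwa [hg.gradient] at this
  have hsup : 0 ≤ δ * v b + F₂ (q + (-β) • w) b := by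
    have hg := ((hasGradientAt_norm_sub_sq a b).const_mul' (-N)).add'
      (hwg.const_mul' (-β))
    have := hv (fun z => -N * ‖z - a‖ ^ 2 + -β * bracket z)
      ((contDiff_const.mul (contDiff_norm_sub_sq a)).add
        (contDiff_const.mul contDiff_bracket)) b
      (Filter.Eventually.of_forall fun z => by
        have := hab (a, z)
        simp only [hΦ, norm_sub_rev z a, norm_sub_rev b a] at this ⊢
        linarith)
    rw [hg.gradient] at this
    have e1 : -N • (2 : ℝ) • (b - a) = q := by
      rw [hq, neg_smul, ← smul_neg, ← smul_neg, neg_sub]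
    rwa [e1] at this
  have hqn : ‖q‖ ≤ 2 * K := by
    rw [hq, norm_smul, norm_smul, Real.norm_of_nonneg hN0.le, Real.norm_of_nonneg two_pos.le]
    linarith
  have hbw : ‖(-β) • w‖ ≤ β := by
    rw [norm_smul, norm_neg, Real.norm_of_nonneg hβ.le]
    nlinarith
  have hL := hlip (q + (-β) • w) q b a
    ((norm_add_le _ _).trans (by linarith)) (by linarith)
  rw [add_sub_cancel_left] at hL
  have hL2 := (abs_le.1 hL).2
  have herr' := herr q a hqn
  have habN : ‖a - b‖ ≤ K / N := by rw [le_div_iff₀ hN0]; linarith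
  have hsq := bracket_le_add a b
  have hfin : Λ * (‖(-β) • w‖ + ‖b - a‖) ≤ Λ * β + Λ * (K / N) := by
    rw [norm_sub_rev b a, ← mul_add]; gcongr
  -- The growing part of the error is absorbed by the penalization: up to `K / N` it is `δ * β *
  -- bracket b`, which also occurs in `δ` times `hgap` and cancels.
  have hfin2 : δ * β * bracket a ≤ δ * β * bracket b + δ * β * (K / N) := by
    rw [← mul_add]; gcongr; linarith
  have hfin3 := mul_le_mul_of_nonneg_left hgap hδ.le
  have e2 : δ * (γ + (e + Λ * β) / δ) = δ * γ + e + Λ * β := by field_simp; ring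
  have e3 : (Λ + δ * β) * K / N = Λ * (K / N) + δ * β * (K / N) := by ring
  rw [e2] at hfin3
  rw [e3] at hN
  nlinarith

/-- Comparison principle, with a uniform error between the two Hamiltonians. -/
theorem IsViscositySub.le_super {d : ℕ} {F₁ F₂ : Space d → Space d → ℝ} {δ K Λ M e : ℝ}
    (hδ : 0 < δ) (hK : 0 ≤ K) (hΛ : 0 ≤ Λ)
    (hlip : ∀ q₁ q₂ x y, ‖q₁‖ ≤ 2 * K + 1 → ‖q₂‖ ≤ 2 * K + 1 →
      |F₂ q₁ x - F₂ q₂ y| ≤ Λ * (‖q₁ - q₂‖ + ‖x - y‖))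
    (herr : ∀ q x, ‖q‖ ≤ 2 * K → F₂ q x - F₁ q x ≤ e)
    {u v : Space d → ℝ} (hu : IsViscositySub F₁ δ u) (hv : IsViscositySuper F₂ δ v)
    (hvc : Continuous v) (huM : ∀ x, u x ≤ M) (hvM : ∀ x, -M ≤ v x)
    (hulip : ∀ x y, u x - u y ≤ K * ‖x - y‖) (x : Space d) :
    u x - v x ≤ e / δ := by
  have t : Tendsto (fun β : ℝ => (e + Λ * β) / δ + β * bracket x) (𝓝[>] 0)
      (𝓝 ((e + Λ * 0) / δ + 0 * bracket x)) :=
    (Continuous.tendsto (by fun_prop) 0).mono_left nhdsWithin_le_nhds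
  have t' : Tendsto (fun β : ℝ => (e + Λ * β) / δ + β * bracket x) (𝓝[>] 0)
      (𝓝 (e / δ)) := by simpa using t
  refine ge_of_tendsto t' ?_
  filter_upwards [Ioc_mem_nhdsGT (zero_lt_one' ℝ)] with β hβ
  refine IsViscositySub.le_of_error hδ hK hΛ hβ.1 hβ.2 hlip (fun q x hq => ?_) hu hv hvc huM hvM
    hulip x
  have : 0 ≤ δ * β * bracket x := by have := hβ.1; have := bracket_pos x; positivity
  linarith [herr q x hq]

/-! ### Bounds and uniqueness for coercive equations -/

/-- Quantitative standing hypotheses on the Hamiltonian `G = G(q, x)` of `δ v + G(Dv, x) = 0`. -/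
structure IsCoerciveHamiltonian {d : ℕ} (G : Space d → Space d → ℝ) (C K Λ : ℝ) : Prop where
  K_pos : 0 < K
  Λ_nonneg : 0 ≤ Λ
  continuous : Continuous fun z : Space d × Space d => G z.1 z.2
  bound : ∀ x, |G 0 x| ≤ C
  coercive : ∀ q x, K ≤ ‖q‖ → C < G q x
  lipschitz : ∀ q₁ q₂ x y, ‖q₁‖ ≤ 2 * K + 1 → ‖q₂‖ ≤ 2 * K + 1 →
    |G q₁ x - G q₂ y| ≤ Λ * (‖q₁ - q₂‖ + ‖x - y‖)

/-- Bounded continuous viscosity solutions of `δ v + G(Dv, x) = 0`. -/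
structure IsBoundedSolution {d : ℕ} (G : Space d → Space d → ℝ) (δ : ℝ) (v : Space d → ℝ) :
    Prop where
  continuous : Continuous v
  bounded : ∃ C : ℝ, ∀ x, |v x| ≤ C
  sub : IsViscositySub G δ v
  super : IsViscositySuper G δ v

theorem IsLocalMax.gradient_eq_zero {d : ℕ} {f : Space d → ℝ} {x : Space d}
    (h : IsLocalMax f x) : gradient f x = 0 := by
  rw [gradient, h.fderiv_eq_zero, map_zero]

theorem IsLocalMin.gradient_eq_zero {d : ℕ} {f : Space d → ℝ} {x : Space d}
    (h : IsLocalMin f x) : gradient f x = 0 := by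
  rw [gradient, h.fderiv_eq_zero, map_zero]

theorem isViscositySub_const {d : ℕ} {G : Space d → Space d → ℝ} {δ c : ℝ}
    (h : ∀ x, δ * c + G 0 x ≤ 0) : IsViscositySub G δ fun _ => c := by
  intro φ _ x hx
  have : IsLocalMin φ x := by
    filter_upwards [hx] with z hz
    linarith
  rw [this.gradient_eq_zero]
  exact h x

theorem isViscositySuper_const {d : ℕ} {G : Space d → Space d → ℝ} {δ c : ℝ}
    (h : ∀ x, 0 ≤ δ * c + G 0 x) : IsViscositySuper G δ fun _ => c := by
  intro φ _ x hx
  have : IsLocalMax φ x := by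
    filter_upwards [hx] with z hz
    linarith
  rw [this.gradient_eq_zero]
  exact h x

theorem gradient_eq_of_isLocalMax_sub {d : ℕ} {f g : Space d → ℝ} {x : Space d}
    (hf : DifferentiableAt ℝ f x) (hg : DifferentiableAt ℝ g x)
    (h : IsLocalMax (fun z => f z - g z) x) : gradient f x = gradient g x := by
  have h1 := h.fderiv_eq_zero
  rw [fderiv_fun_sub hf hg, sub_eq_zero] at h1
  rw [gradient, gradient, h1]

theorem continuous_gradient_of_contDiff {d : ℕ} {φ : Space d → ℝ} (h : ContDiff ℝ 2 φ) :
    Continuous (gradient φ) :=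
  (InnerProductSpace.toDual ℝ (Space d)).symm.continuous.comp (h.continuous_fderiv (by norm_num))

namespace IsCoerciveHamiltonian

variable {d : ℕ} {G : Space d → Space d → ℝ} {C K Λ δ : ℝ} {u v : Space d → ℝ}

theorem lipschitz_of_sub (hG : IsCoerciveHamiltonian G C K Λ)
    (hu : IsViscositySub G δ u) (huc : Continuous u) {M : ℝ} (huM : ∀ x, u x ≤ M)
    (huC : ∀ x, -C ≤ δ * u x) (x y : Space d) : u x - u y ≤ K * ‖x - y‖ :=
  hu.lipschitz hG.K_pos hG.coercive huc huM huC x y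

theorem comparison (hG : IsCoerciveHamiltonian G C K Λ) (hδ : 0 < δ)
    (hu : IsViscositySub G δ u) {M₁ : ℝ} (huM : ∀ x, u x ≤ M₁)
    (hulip : ∀ x y, u x - u y ≤ K * ‖x - y‖) (hv : IsViscositySuper G δ v) (hvc : Continuous v)
    {M₂ : ℝ} (hvM : ∀ x, M₂ ≤ v x) (x : Space d) : u x ≤ v x := by
  have := IsViscositySub.le_super hδ hG.K_pos.le hG.Λ_nonneg hG.lipschitz (e := 0)
    (fun q x _ => by simp) hu hv hvc (M := max M₁ (-M₂)) (fun x => (huM x).trans (le_max_left _ _))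
    (fun x => by have := hvM x; have := le_max_right M₁ (-M₂); linarith) hulip x
  simpa using this

/-- The constant `C / δ` is a supersolution. The lower bound on `δ * u` is what makes `u` Lipschitz,
as comparison requires of the subsolution. -/
theorem le_of_sub (hG : IsCoerciveHamiltonian G C K Λ) (hδ : 0 < δ)
    (hu : IsViscositySub G δ u) (huc : Continuous u) {M : ℝ} (huM : ∀ x, u x ≤ M)
    (huC : ∀ x, -C ≤ δ * u x) (x : Space d) : δ * u x ≤ C := by
  have := hG.comparison hδ hu huM (hG.lipschitz_of_sub hu huc huM huC)
    (isViscositySuper_const (c := C / δ) fun x => by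
      rw [mul_div_cancel₀ _ hδ.ne']; linarith [(abs_le.1 (hG.bound x)).1])
    continuous_const (fun _ => le_rfl) x
  rwa [le_div_iff₀' hδ] at this

/-- The constant `-C / δ` is a trivially Lipschitz subsolution, so no regularity of `v` beyond
continuity is needed. This is the bound from which the Lipschitz estimate for solutions starts. -/
theorem neg_le_of_super (hG : IsCoerciveHamiltonian G C K Λ) (hδ : 0 < δ)
    (hv : IsViscositySuper G δ v) (hvc : Continuous v) {M : ℝ} (hvM : ∀ x, M ≤ v x)
    (x : Space d) : -C ≤ δ * v x := by
  have := hG.comparison hδ (isViscositySub_const (c := -C / δ) fun x => by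
      rw [mul_div_cancel₀ _ hδ.ne']; linarith [(abs_le.1 (hG.bound x)).2])
    (fun _ => le_rfl) (fun x y => by
      rw [sub_self]; have := hG.K_pos; positivity) hv hvc hvM x
  rwa [div_le_iff₀' hδ] at this

theorem neg_le_of_solution (hG : IsCoerciveHamiltonian G C K Λ) (hδ : 0 < δ)
    (hv : IsBoundedSolution G δ v) (x : Space d) : -C ≤ δ * v x := by
  obtain ⟨M, hM⟩ := hv.bounded
  exact hG.neg_le_of_super hδ hv.super hv.continuous (fun x => (abs_le.1 (hM x)).1) x

theorem abs_solution_le (hG : IsCoerciveHamiltonian G C K Λ) (hδ : 0 < δ)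
    (hv : IsBoundedSolution G δ v) (x : Space d) : |δ * v x| ≤ C := by
  obtain ⟨M, hM⟩ := hv.bounded
  exact abs_le.2 ⟨hG.neg_le_of_solution hδ hv x, hG.le_of_sub hδ hv.sub hv.continuous
    (fun x => (abs_le.1 (hM x)).2) (hG.neg_le_of_solution hδ hv) x⟩

theorem lipschitz_solution (hG : IsCoerciveHamiltonian G C K Λ) (hδ : 0 < δ)
    (hv : IsBoundedSolution G δ v) (x y : Space d) : v x - v y ≤ K * ‖x - y‖ := by
  obtain ⟨M, hM⟩ := hv.bounded
  exact hG.lipschitz_of_sub hv.sub hv.continuous (fun x => (abs_le.1 (hM x)).2)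
    (hG.neg_le_of_solution hδ hv) x y

theorem abs_sub_solution_le (hG : IsCoerciveHamiltonian G C K Λ) (hδ : 0 < δ)
    (hv : IsBoundedSolution G δ v) (x y : Space d) : |v x - v y| ≤ K * ‖x - y‖ := by
  rw [abs_le]
  have h1 := hG.lipschitz_solution hδ hv x y
  have h2 := hG.lipschitz_solution hδ hv y x
  rw [norm_sub_rev] at h2
  constructor <;> linarith

theorem solution_unique (hG : IsCoerciveHamiltonian G C K Λ) (hδ : 0 < δ)
    (hu : IsBoundedSolution G δ u) (hv : IsBoundedSolution G δ v) : u = v := by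
  obtain ⟨M, hM⟩ := hu.bounded
  obtain ⟨N, hN⟩ := hv.bounded
  funext x
  exact le_antisymm
    (hG.comparison hδ hu.sub (fun x => (abs_le.1 (hM x)).2) (hG.lipschitz_solution hδ hu)
      hv.super hv.continuous (fun x => (abs_le.1 (hN x)).1) x)
    (hG.comparison hδ hv.sub (fun x => (abs_le.1 (hN x)).2) (hG.lipschitz_solution hδ hv)
      hu.super hu.continuous (fun x => (abs_le.1 (hM x)).1) x)

/-! ### Existence by Perron's method -/

/-- The class of subsolutions whose upper envelope is the solution. -/
def perronClass (G : Space d → Space d → ℝ) (C δ : ℝ) : Set (Space d → ℝ) :=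
  {u | Continuous u ∧ IsViscositySub G δ u ∧ ∀ x, |δ * u x| ≤ C}

/-- The upper envelope of the subsolutions. -/
noncomputable def perronSup (G : Space d → Space d → ℝ) (C δ : ℝ) (x : Space d) : ℝ :=
  sSup ((fun u : Space d → ℝ => u x) '' perronClass G C δ)

theorem const_mem_perronClass (hG : IsCoerciveHamiltonian G C K Λ) (hδ : 0 < δ) :
    (fun _ => -C / δ) ∈ perronClass G C δ := by
  refine ⟨continuous_const, isViscositySub_const fun x => ?_, fun x => ?_⟩
  · rw [mul_div_cancel₀ _ hδ.ne']; linarith [(abs_le.1 (hG.bound x)).2]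
  · rw [mul_div_cancel₀ _ hδ.ne', abs_neg, abs_of_nonneg]
    exact (abs_nonneg _).trans (hG.bound x)

theorem bddAbove_perron (hδ : 0 < δ) (x : Space d) :
    BddAbove ((fun u : Space d → ℝ => u x) '' perronClass G C δ) := by
  refine ⟨C / δ, ?_⟩
  rintro _ ⟨u, hu, rfl⟩
  rw [le_div_iff₀' hδ]
  exact (abs_le.1 (hu.2.2 x)).2

theorem le_perronSup (hδ : 0 < δ) (hu : u ∈ perronClass G C δ) (x : Space d) :
    u x ≤ perronSup G C δ x := le_csSup (bddAbove_perron hδ x) ⟨u, hu, rfl⟩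

theorem exists_lt_perronSup (hG : IsCoerciveHamiltonian G C K Λ) (hδ : 0 < δ) (x : Space d)
    {ε : ℝ} (hε : 0 < ε) : ∃ u ∈ perronClass G C δ, perronSup G C δ x - ε < u x := by
  obtain ⟨_, ⟨u, hu, rfl⟩, h⟩ := exists_lt_of_lt_csSup
    (s := (fun u : Space d → ℝ => u x) '' perronClass G C δ)
    ⟨_, _, hG.const_mem_perronClass hδ, rfl⟩ (sub_lt_self (perronSup G C δ x) hε)
  exact ⟨u, hu, h⟩

/-- The lower bound built into the class gives all its members the same Lipschitz constant, so the
envelope is continuous and semicontinuous envelopes can be avoided. -/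
theorem lipschitz_of_mem_perronClass (hG : IsCoerciveHamiltonian G C K Λ) (hδ : 0 < δ)
    (hu : u ∈ perronClass G C δ) (x y : Space d) : u x - u y ≤ K * ‖x - y‖ :=
  hG.lipschitz_of_sub hu.2.1 hu.1 (M := C / δ)
    (fun x => by rw [le_div_iff₀' hδ]; exact (abs_le.1 (hu.2.2 x)).2)
    (fun x => (abs_le.1 (hu.2.2 x)).1) x y

theorem lipschitz_perronSup (hG : IsCoerciveHamiltonian G C K Λ) (hδ : 0 < δ) (x y : Space d) :
    perronSup G C δ x - perronSup G C δ y ≤ K * ‖x - y‖ := by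
  refine le_of_forall_pos_le_add fun ε hε => ?_
  obtain ⟨u, hu, h⟩ := hG.exists_lt_perronSup hδ x hε
  have h1 := hG.lipschitz_of_mem_perronClass hδ hu x y
  have h2 := le_perronSup hδ hu y
  linarith

theorem continuous_perronSup (hG : IsCoerciveHamiltonian G C K Λ) (hδ : 0 < δ) :
    Continuous (perronSup G C δ) := by
  refine (LipschitzWith.of_le_add_mul K.toNNReal fun x y => ?_).continuous
  rw [Real.coe_toNNReal _ hG.K_pos.le, dist_eq_norm]
  linarith [hG.lipschitz_perronSup hδ x y]

theorem abs_perronSup_le (hG : IsCoerciveHamiltonian G C K Λ) (hδ : 0 < δ) (x : Space d) :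
    |δ * perronSup G C δ x| ≤ C := by
  rw [abs_le]
  constructor
  · have := le_perronSup hδ (hG.const_mem_perronClass hδ) x
    rwa [div_le_iff₀' hδ] at this
  · rw [← le_div_iff₀' hδ]
    refine csSup_le ⟨_, _, hG.const_mem_perronClass hδ, rfl⟩ ?_
    rintro _ ⟨u, hu, rfl⟩
    rw [le_div_iff₀' hδ]
    exact (abs_le.1 (hu.2.2 x)).2

/-- The upper envelope of the subsolutions is a subsolution. -/
theorem perronSup_sub (hG : IsCoerciveHamiltonian G C K Λ) (hδ : 0 < δ) :
    IsViscositySub G δ (perronSup G C δ) := by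
  intro φ hφ x hx
  set V := perronSup G C δ with hV
  -- The added square makes the maximum at `x` strict without changing the gradient there.
  set ψ : Space d → ℝ := fun z => φ z + 1 * ‖z - x‖ ^ 2 with hψ
  have hψc : ContDiff ℝ 2 ψ := hφ.add (contDiff_const.mul (contDiff_norm_sub_sq x))
  have hgrad : gradient ψ x = gradient φ x := by
    have h1 := ((hφ.differentiable (by norm_num) x).hasGradientAt).add'
      ((hasGradientAt_norm_sub_sq x x).const_mul' 1)
    simpa [hψ] using h1.gradient
  obtain ⟨r, hr, hball⟩ := Metric.eventually_nhds_iff_ball.1 hx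
  -- near-touching points of the elements of the class
  have key : ∀ ε > 0, ∃ y, ‖y - x‖ ≤ ε ∧
      δ * (V x - ε ^ 2 - K * ε) + G (gradient ψ y) y ≤ 0 := by
    intro ε hε
    obtain ⟨η, hη, hηr, hηε⟩ : ∃ η > 0, η < r ∧ η ≤ ε :=
      ⟨min (r / 2) ε, by positivity, (min_le_left _ _).trans_lt (by linarith), min_le_right _ _⟩
    -- A deficit `η ^ 2` is matched to the quadratic growth of `ψ - φ`: it forces the maximum point
    -- `y` of `u - ψ` to lie strictly inside the ball of radius `η`, hence to be a local maximum.
    obtain ⟨u, hu, hux⟩ := hG.exists_lt_perronSup hδ x (ε := η ^ 2) (by positivity)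
    obtain ⟨y, hy, hymax⟩ := (isCompact_closedBall x η).exists_isMaxOn
      ⟨x, Metric.mem_closedBall_self hη.le⟩
      ((hu.1.sub hψc.continuous).continuousOn (s := Metric.closedBall x η))
    have hyr : y ∈ Metric.ball x r := Metric.closedBall_subset_ball hηr hy
    have h1 : u x - ψ x ≤ u y - ψ y := hymax (Metric.mem_closedBall_self hη.le)
    have h2 : V y - φ y ≤ V x - φ x := hball y hyr
    have h3 := le_perronSup hδ hu y
    simp only [hψ, sub_self, norm_zero] at h1
    have h4 : ‖y - x‖ ^ 2 < η ^ 2 := by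
      rw [← hV] at h3 hux
      nlinarith
    have h5 : ‖y - x‖ < η := lt_of_pow_lt_pow_left₀ 2 hη.le h4
    have h6 : IsLocalMax (fun z => u z - ψ z) y := by
      filter_upwards [Metric.isOpen_ball.mem_nhds
        (show y ∈ Metric.ball x η by rwa [Metric.mem_ball, dist_eq_norm])] with z hz
      exact hymax (Metric.ball_subset_closedBall hz)
    have h7 := hu.2.1 ψ hψc y h6
    have h8 := hG.lipschitz_of_mem_perronClass hδ hu x y
    rw [norm_sub_rev] at h8
    have h9 : K * ‖y - x‖ ≤ K * ε := by have := hG.K_pos; gcongr; linarith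
    have h10 : η ^ 2 ≤ ε ^ 2 := by gcongr
    refine ⟨y, h5.le.trans hηε, ?_⟩
    have : δ * (V x - ε ^ 2 - K * ε) ≤ δ * u y := by
      gcongr
      linarith
    linarith
  choose! y hy1 hy2 using key
  have hyt : Tendsto y (𝓝[>] 0) (𝓝 x) := by
    rw [tendsto_iff_norm_sub_tendsto_zero]
    refine squeeze_zero' (Eventually.of_forall fun _ => norm_nonneg _)
      (eventually_mem_nhdsWithin.mono hy1) ?_
    exact tendsto_id.mono_left nhdsWithin_le_nhds
  have ht1 : Tendsto (fun ε => G (gradient ψ (y ε)) (y ε)) (𝓝[>] 0) (𝓝 (G (gradient ψ x) x)) :=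
    (hG.continuous.comp ((continuous_gradient_of_contDiff hψc).prodMk continuous_id)).tendsto x
      |>.comp hyt
  have ht2 : Tendsto (fun ε : ℝ => δ * (V x - ε ^ 2 - K * ε)) (𝓝[>] 0)
      (𝓝 (δ * (V x - 0 ^ 2 - K * 0))) :=
    (Continuous.tendsto (by fun_prop) 0).mono_left nhdsWithin_le_nhds
  have := le_of_tendsto (ht2.add ht1) (eventually_mem_nhdsWithin.mono hy2)
  rw [hgrad] at this
  simpa using this

open scoped Classical in
/-- Raising a subsolution locally by a smooth strict subsolution. -/
theorem isViscositySub_bump {V ψ : Space d → ℝ} (hV : IsViscositySub G δ V) (hVc : Continuous V)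
    (hψ : ContDiff ℝ 2 ψ) {x : Space d} {r : ℝ}
    (hψs : ∀ y ∈ Metric.ball x r, δ * ψ y + G (gradient ψ y) y ≤ 0)
    (hout : ∀ y, r / 2 ≤ dist y x → dist y x < r → ψ y ≤ V y) (hr : 0 < r) :
    Continuous (fun y => if dist y x < r then max (V y) (ψ y) else V y) ∧
    IsViscositySub G δ (fun y => if dist y x < r then max (V y) (ψ y) else V y) := by
  set U : Space d → ℝ := fun y => if dist y x < r then max (V y) (ψ y) else V y with hU
  have hVU : ∀ y, V y ≤ U y := fun y => by
    simp only [hU]; split_ifs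
    · exact le_max_left _ _
    · exact le_rfl
  have hin : ∀ y, dist y x < r → U =ᶠ[𝓝 y] fun y => max (V y) (ψ y) := fun y hy => by
    filter_upwards [(continuous_id.dist continuous_const).tendsto y |>.eventually_lt_const hy]
      with z hz
    exact if_pos hz
  -- On the annulus `r / 2 ≤ dist y x < r` the bump lies below `V`, so the two definitions of `U`
  -- glue continuously.
  have hfar : ∀ y, r / 2 < dist y x → U =ᶠ[𝓝 y] V := fun y hy => by
    filter_upwards [(continuous_id.dist continuous_const).tendsto y |>.eventually_const_lt hy]
      with z hz
    simp only [hU]; split_ifs with h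
    · exact max_eq_left (hout z hz.le h)
    · rfl
  refine ⟨continuous_iff_continuousAt.2 fun y => ?_, fun φ hφ y hy => ?_⟩
  · rcases lt_or_ge (dist y x) r with h | h
    · exact ((hVc.max hψ.continuous).continuousAt).congr (hin y h).symm
    · exact hVc.continuousAt.congr (hfar y (by linarith)).symm
  -- Where `U` equals `V`, the inequality `V ≤ U` lets `φ` touch `V` from above as well. Elsewhere
  -- `φ` touches the smooth `ψ`, and their gradients agree.
  · by_cases hUV : U y = V y
    · rw [hUV]
      refine hV φ hφ y ?_
      filter_upwards [hy] with z hz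
      rw [hUV] at hz
      linarith [hVU z]
    · have hyr : dist y x < r := by
        by_contra h
        exact hUV (if_neg h)
      have hUy : U y = max (V y) (ψ y) := if_pos hyr
      have hUψ : U y = ψ y := by
        rcases max_choice (V y) (ψ y) with h | h
        · exact absurd (hUy.trans h) hUV
        · exact hUy.trans h
      have hmax : IsLocalMax (fun z => ψ z - φ z) y := by
        filter_upwards [hy, hin y hyr] with z hz hz2
        rw [hUψ, hz2] at hz
        linarith [le_max_right (V z) (ψ z)]
      rw [hUψ, ← gradient_eq_of_isLocalMax_sub (hψ.differentiable (by norm_num) y)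
        (hφ.differentiable (by norm_num) y) hmax]
      exact hψs y hyr

/-- The upper envelope of the subsolutions is a supersolution. -/
theorem perronSup_super (hG : IsCoerciveHamiltonian G C K Λ) (hδ : 0 < δ) :
    IsViscositySuper G δ (perronSup G C δ) := by
  classical
  intro φ hφ x hx
  by_contra! hneg
  set V := perronSup G C δ with hV
  -- the smooth function touching `V` strictly from below at `x`, raised by `η`
  set ψ : ℝ → Space d → ℝ := fun η z => φ z + (-1) * ‖z - x‖ ^ 2 + (V x - φ x + η) with hψ
  have hψc : ∀ η, ContDiff ℝ 2 (ψ η) := fun η =>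
    (hφ.add (contDiff_const.mul (contDiff_norm_sub_sq x))).add contDiff_const
  have hgradz : ∀ η z, gradient (ψ η) z = gradient φ z + (-1 : ℝ) • (2 : ℝ) • (z - x) := by
    intro η z
    have h1 := (((hφ.differentiable (by norm_num) z).hasGradientAt).add'
      ((hasGradientAt_norm_sub_sq x z).const_mul' (-1))).add' (hasGradientAt_const z (V x - φ x + η))
    rw [add_zero] at h1
    exact h1.gradient
  -- strict inequality near `x`
  have hcont : Continuous fun w : ℝ × Space d => δ * ψ w.1 w.2 +
      G (gradient φ w.2 + (-1 : ℝ) • (2 : ℝ) • (w.2 - x)) w.2 := by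
    have h1 : Continuous fun w : ℝ × Space d =>
        G (gradient φ w.2 + (-1 : ℝ) • (2 : ℝ) • (w.2 - x)) w.2 := by
      have := continuous_gradient_of_contDiff hφ
      exact hG.continuous.comp (Continuous.prodMk (by fun_prop) continuous_snd)
    have h2 : Continuous fun w : ℝ × Space d => φ w.2 := hφ.continuous.comp continuous_snd
    exact (continuous_const.mul (by fun_prop)).add h1
  have hlt : ∀ᶠ w in 𝓝 ((0 : ℝ), x), δ * ψ w.1 w.2 +
      G (gradient φ w.2 + (-1 : ℝ) • (2 : ℝ) • (w.2 - x)) w.2 < 0 := by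
    refine hcont.continuousAt.eventually_lt_const ?_
    simpa [hψ] using hneg
  rw [Metric.eventually_nhds_iff] at hlt
  obtain ⟨r₁, hr₁, hlt⟩ := hlt
  obtain ⟨r₂, hr₂, hmin⟩ := Metric.eventually_nhds_iff.1 hx
  set r := min r₁ r₂ with hr
  have hr0 : 0 < r := by positivity
  -- `η < r` keeps `(η, y)` in the neighbourhood of the strict inequality; `η ≤ (r / 2) ^ 2` lets
  -- the subtracted square outweigh the raise on the annulus.
  obtain ⟨η, hη, hηr, hηr2⟩ : ∃ η > 0, η < r ∧ η ≤ (r / 2) ^ 2 :=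
    ⟨min (r / 2) ((r / 2) ^ 2), by positivity, (min_le_left _ _).trans_lt (by linarith),
      min_le_right _ _⟩
  obtain ⟨hUc, hUs⟩ := isViscositySub_bump (x := x) (r := r) (hG.perronSup_sub hδ)
    (hG.continuous_perronSup hδ) (hψc η) (fun y hy => by
      rw [hgradz]
      refine (hlt (y := (η, y)) ?_).le
      rw [Prod.dist_eq, max_lt_iff]
      refine ⟨?_, (Metric.mem_ball.1 hy).trans_le (min_le_left _ _)⟩
      rw [Real.dist_eq, sub_zero, abs_of_pos hη]
      exact hηr.trans_le (min_le_left _ _)) (fun y hy1 hy2 => by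
      have h1 := hmin (hy2.trans_le (min_le_right _ _))
      rw [dist_eq_norm] at hy1
      have h2 : (r / 2) ^ 2 ≤ ‖y - x‖ ^ 2 := by gcongr
      simp only [hψ]
      linarith) hr0
  rw [← hV] at hUc hUs
  set U : Space d → ℝ := fun y => if dist y x < r then max (V y) (ψ η y) else V y with hU
  have hVU : ∀ y, V y ≤ U y := fun y => by
    simp only [hU]; split_ifs
    · exact le_max_left _ _
    · exact le_rfl
  have hVC : ∀ y, |δ * V y| ≤ C := hG.abs_perronSup_le hδ
  have hUC : ∀ y, -C ≤ δ * U y := fun y =>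
    (abs_le.1 (hVC y)).1.trans (mul_le_mul_of_nonneg_left (hVU y) hδ.le)
  obtain ⟨M, hM⟩ : ∃ M, ∀ y, U y ≤ M := by
    obtain ⟨m, hm⟩ := (isCompact_closedBall x r).bddAbove_image (hψc η).continuous.continuousOn
    refine ⟨max (C / δ) m, fun y => ?_⟩
    have h1 : V y ≤ C / δ := by rw [le_div_iff₀' hδ]; exact (abs_le.1 (hVC y)).2
    simp only [hU]; split_ifs with h
    · exact max_le_max h1 (hm ⟨y, h.le, rfl⟩)
    · exact h1.trans (le_max_left _ _)
  -- The upper bound `δ * U ≤ C` comes from comparison, not from smallness of `η`. Membership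
  -- contradicts maximality, since `U x ≥ V x + η`.
  have hUmem : U ∈ perronClass G C δ :=
    ⟨hUc, hUs, fun y => abs_le.2 ⟨hUC y, hG.le_of_sub hδ hUs hUc hM hUC y⟩⟩
  have h1 := le_perronSup hδ hUmem x
  have h2 : ψ η x ≤ U x := by
    simp only [hU, dist_self, if_pos hr0]; exact le_max_right _ _
  have h3 : ψ η x = V x + η := by simp [hψ]; ring
  rw [← hV] at h1
  linarith

theorem exists_solution (hG : IsCoerciveHamiltonian G C K Λ) (hδ : 0 < δ) :
    ∃ v, IsBoundedSolution G δ v :=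
  ⟨perronSup G C δ, hG.continuous_perronSup hδ, ⟨C / δ, fun x => by
    have := hG.abs_perronSup_le hδ x
    rw [abs_mul, abs_of_pos hδ] at this
    rwa [le_div_iff₀' hδ]⟩, hG.perronSup_sub hδ, hG.perronSup_super hδ⟩

end IsCoerciveHamiltonian

/-! ### Continuous dependence and stability -/

namespace IsCoerciveHamiltonian

variable {d : ℕ} {G G₁ G₂ : Space d → Space d → ℝ} {C K Λ δ : ℝ} {u v : Space d → ℝ}

theorem abs_le_of_norm_le (hG : IsCoerciveHamiltonian G C K Λ) {q x : Space d}
    (hq : ‖q‖ ≤ 2 * K + 1) : |G q x| ≤ C + Λ * (2 * K + 1) := by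
  have h1 := hG.lipschitz q 0 x x hq (by rw [norm_zero]; have := hG.K_pos; positivity)
  rw [sub_zero, sub_self, norm_zero, add_zero] at h1
  have h2 := hG.bound x
  have h3 : Λ * ‖q‖ ≤ Λ * (2 * K + 1) := mul_le_mul_of_nonneg_left hq hG.Λ_nonneg
  have h4 := abs_sub_abs_le_abs_sub (G q x) (G 0 x)
  linarith

/-- Continuous dependence of the solution on the Hamiltonian, with an error growing at
infinity. -/
theorem abs_sub_le_of_error (hG₁ : IsCoerciveHamiltonian G₁ C K Λ)
    (hG₂ : IsCoerciveHamiltonian G₂ C K Λ) (hδ : 0 < δ) {β : ℝ} (hβ : 0 < β) (hβ1 : β ≤ 1)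
    (herr : ∀ q x, ‖q‖ ≤ 2 * K → |G₁ q x - G₂ q x| ≤ δ * β * bracket x)
    (hu : IsBoundedSolution G₁ δ u) (hv : IsBoundedSolution G₂ δ v) (x : Space d) :
    |u x - v x| ≤ Λ * β / δ + β * bracket x := by
  obtain ⟨M, hM⟩ := hu.bounded
  obtain ⟨N, hN⟩ := hv.bounded
  have h1 := IsViscositySub.le_of_error hδ hG₂.K_pos.le hG₂.Λ_nonneg hβ hβ1 hG₂.lipschitz (e := 0)
    (fun q x hq => by have := (abs_le.1 (herr q x hq)).1; linarith) hu.sub hv.super hv.continuous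
    (M := max M N) (fun x => (abs_le.1 (hM x)).2.trans (le_max_left _ _))
    (fun x => by have := (abs_le.1 (hN x)).1; have := le_max_right M N; linarith)
    (hG₁.lipschitz_solution hδ hu) x
  have h2 := IsViscositySub.le_of_error hδ hG₁.K_pos.le hG₁.Λ_nonneg hβ hβ1 hG₁.lipschitz (e := 0)
    (fun q x hq => by have := (abs_le.1 (herr q x hq)).2; linarith) hv.sub hu.super hu.continuous
    (M := max M N) (fun x => (abs_le.1 (hN x)).2.trans (le_max_right _ _))
    (fun x => by have := (abs_le.1 (hM x)).1; have := le_max_left M N; linarith)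
    (hG₂.lipschitz_solution hδ hv) x
  rw [zero_add] at h1 h2
  rw [abs_le]
  constructor <;> linarith

/-- Continuous dependence of the solution on the Hamiltonian, with a uniform error. -/
theorem abs_sub_le_of_uniform (hG₁ : IsCoerciveHamiltonian G₁ C K Λ)
    (hG₂ : IsCoerciveHamiltonian G₂ C K Λ) (hδ : 0 < δ) {e : ℝ}
    (herr : ∀ q x, ‖q‖ ≤ 2 * K → |G₁ q x - G₂ q x| ≤ e)
    (hu : IsBoundedSolution G₁ δ u) (hv : IsBoundedSolution G₂ δ v) (x : Space d) :
    |u x - v x| ≤ e / δ := by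
  obtain ⟨M, hM⟩ := hu.bounded
  obtain ⟨N, hN⟩ := hv.bounded
  have h1 := IsViscositySub.le_super hδ hG₂.K_pos.le hG₂.Λ_nonneg hG₂.lipschitz (e := e)
    (fun q x hq => by have := (abs_le.1 (herr q x hq)).1; linarith) hu.sub hv.super hv.continuous
    (M := max M N) (fun x => (abs_le.1 (hM x)).2.trans (le_max_left _ _))
    (fun x => by have := (abs_le.1 (hN x)).1; have := le_max_right M N; linarith)
    (hG₁.lipschitz_solution hδ hu) x
  have h2 := IsViscositySub.le_super hδ hG₁.K_pos.le hG₁.Λ_nonneg hG₁.lipschitz (e := e)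
    (fun q x hq => by have := (abs_le.1 (herr q x hq)).2; linarith) hv.sub hu.super hu.continuous
    (M := max M N) (fun x => (abs_le.1 (hN x)).2.trans (le_max_right _ _))
    (fun x => by have := (abs_le.1 (hM x)).1; have := le_max_left M N; linarith)
    (hG₂.lipschitz_solution hδ hv) x
  rw [abs_le]
  constructor <;> linarith

theorem abs_solution_le_div (hG : IsCoerciveHamiltonian G C K Λ) (hδ : 0 < δ)
    (hv : IsBoundedSolution G δ v) (x : Space d) : |v x| ≤ C / δ := by
  have h := hG.abs_solution_le hδ hv x
  rw [abs_mul, abs_of_pos hδ] at h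
  rwa [le_div_iff₀' hδ]

/-- Dependence of the solution on the discount `δ`: one-sided estimate. -/
theorem sub_le_of_discount (hG : IsCoerciveHamiltonian G C K Λ) {η : ℝ} (hδ : 0 < δ) (hη : 0 < η)
    (hu : IsBoundedSolution G η u) (hv : IsBoundedSolution G δ v) (x : Space d) :
    u x - v x ≤ |η - δ| * (C / η) / δ := by
  obtain ⟨M, hM⟩ := hu.bounded
  obtain ⟨N, hN⟩ := hv.bounded
  have hub : ∀ x, |u x| ≤ C / η := hG.abs_solution_le_div hη hu
  -- With discount `δ`, `u` is a subsolution for the Hamiltonian `G + (η - δ) * u`, which is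
  -- uniformly close to `G`.
  refine IsViscositySub.le_super (F₁ := fun q x => G q x + (η - δ) * u x) hδ hG.K_pos.le
    hG.Λ_nonneg hG.lipschitz (fun q x _ => ?_) (fun φ hφ x hx => ?_) hv.super hv.continuous
    (M := max M N) (fun x => (abs_le.1 (hM x)).2.trans (le_max_left _ _))
    (fun x => by have := (abs_le.1 (hN x)).1; have := le_max_right M N; linarith)
    (hG.lipschitz_solution hη hu) x
  · have h1 : |(η - δ) * u x| ≤ |η - δ| * (C / η) := by
      rw [abs_mul]; exact mul_le_mul_of_nonneg_left (hub x) (abs_nonneg _)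
    have := (abs_le.1 h1).1
    linarith
  · have := hu.sub φ hφ x hx
    linarith

/-- `δ v^δ` varies slowly with `δ`. -/
theorem abs_discount_mul_sub_le (hG : IsCoerciveHamiltonian G C K Λ) {η : ℝ} (hδ : 0 < δ)
    (hη : 0 < η) (hu : IsBoundedSolution G η u) (hv : IsBoundedSolution G δ v) (x : Space d) :
    |δ * v x - η * u x| ≤ 2 * C * |δ - η| / η := by
  have hC : 0 ≤ C := (abs_nonneg _).trans (hG.bound 0)
  have h1 := hG.sub_le_of_discount hδ hη hu hv x
  have h2 := hG.sub_le_of_discount hη hδ hv hu x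
  have h3 : |u x| ≤ C / η := hG.abs_solution_le_div hη hu x
  rw [abs_sub_comm η δ] at h1
  have h4 : |v x - u x| ≤ |δ - η| * C / (η * δ) := by
    have e1 : |δ - η| * (C / η) / δ = |δ - η| * C / (η * δ) := by field_simp
    have e2 : |δ - η| * (C / δ) / η = |δ - η| * C / (η * δ) := by field_simp
    rw [e1] at h1; rw [e2] at h2
    rw [abs_le]; constructor <;> linarith
  calc |δ * v x - η * u x| = |δ * (v x - u x) + (δ - η) * u x| := by congr 1; ring
    _ ≤ |δ * (v x - u x)| + |(δ - η) * u x| := abs_add_le _ _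
    _ = δ * |v x - u x| + |δ - η| * |u x| := by rw [abs_mul, abs_mul, abs_of_pos hδ]
    _ ≤ δ * (|δ - η| * C / (η * δ)) + |δ - η| * (C / η) := by gcongr
    _ = 2 * C * |δ - η| / η := by field_simp; ring

/-- Convergence of Hamiltonians on a dense set of points is locally uniform. -/
theorem eventually_abs_sub_le_on_compact {ι : Type*} {l : Filter ι}
    {F : ι → Space d → Space d → ℝ} (hF : ∀ i, IsCoerciveHamiltonian (F i) C K Λ)
    (hG : IsCoerciveHamiltonian G C K Λ) {a : ℕ → Space d × Space d} (ha : DenseRange a)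
    (hlim : ∀ n, Tendsto (fun i => F i (a n).1 (a n).2) l (𝓝 (G (a n).1 (a n).2)))
    (R : ℝ) {ε : ℝ} (hε : 0 < ε) :
    ∀ᶠ i in l, ∀ q x, ‖q‖ ≤ 2 * K → ‖x‖ ≤ R → |F i q x - G q x| ≤ ε := by
  -- Moving to a sample point within `ρ` costs `2 * Λ * ρ` for each of `F i` and `G`; `ρ ≤ 1` keeps
  -- the sample momentum within `2 * K + 1`.
  obtain ⟨ρ, hρ, hρ1, hρε⟩ : ∃ ρ > 0, ρ ≤ 1 ∧ 4 * Λ * ρ ≤ ε / 2 := by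
    have hΛ := hG.Λ_nonneg
    refine ⟨min 1 (ε / (8 * (Λ + 1))), by positivity, min_le_left _ _, ?_⟩
    calc 4 * Λ * min 1 (ε / (8 * (Λ + 1))) ≤ 4 * (Λ + 1) * (ε / (8 * (Λ + 1))) := by
          gcongr
          · linarith
          · exact min_le_right _ _
      _ = ε / 2 := by field_simp; norm_num
  obtain ⟨t, ht⟩ := ((isCompact_closedBall (0 : Space d) (2 * K)).prod
    (isCompact_closedBall (0 : Space d) R)).elim_finite_subcover
    (fun n => Metric.ball (a n) ρ) (fun _ => Metric.isOpen_ball) (fun z _ => by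
      obtain ⟨n, hn⟩ := ha.exists_dist_lt z hρ
      exact mem_iUnion.2 ⟨n, hn⟩)
  have hev : ∀ᶠ i in l, ∀ n ∈ t, |F i (a n).1 (a n).2 - G (a n).1 (a n).2| < ε / 2 := by
    rw [Filter.eventually_all_finset]
    intro n _
    exact (Metric.tendsto_nhds.1 (hlim n)) (ε / 2) (by positivity)
  filter_upwards [hev] with i hi q x hq hx
  obtain ⟨n, hn, hz⟩ : ∃ n ∈ t, (q, x) ∈ Metric.ball (a n) ρ := by
    have := ht (show (q, x) ∈ _ from ⟨by simpa using hq, by simpa using hx⟩)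
    simpa using this
  rw [Metric.mem_ball, Prod.dist_eq, max_lt_iff, dist_eq_norm, dist_eq_norm] at hz
  obtain ⟨hz1, hz2⟩ := hz
  simp only at hz1 hz2
  have hqa : ‖(a n).1‖ ≤ 2 * K + 1 := by
    have := norm_sub_norm_le (a n).1 q
    rw [norm_sub_rev] at this
    linarith
  have h1 := (hF i).lipschitz q (a n).1 x (a n).2 (by linarith) hqa
  have h2 := hG.lipschitz q (a n).1 x (a n).2 (by linarith) hqa
  have h3 : Λ * (‖q - (a n).1‖ + ‖x - (a n).2‖) ≤ Λ * (ρ + ρ) := by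
    have := hG.Λ_nonneg
    gcongr
  have h4 := hi n hn
  rw [abs_le] at h1 h2 ⊢
  rw [abs_lt] at h4
  constructor <;> linarith

/-- Stability of the solution under convergence of the Hamiltonian on a dense set of points. -/
theorem tendsto_solution {ι : Type*} {l : Filter ι}
    {F : ι → Space d → Space d → ℝ} (hF : ∀ i, IsCoerciveHamiltonian (F i) C K Λ)
    (hG : IsCoerciveHamiltonian G C K Λ) (hδ : 0 < δ) {a : ℕ → Space d × Space d}
    (ha : DenseRange a)
    (hlim : ∀ n, Tendsto (fun i => F i (a n).1 (a n).2) l (𝓝 (G (a n).1 (a n).2)))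
    {w : ι → Space d → ℝ} (hw : ∀ i, IsBoundedSolution (F i) δ (w i))
    (hv : IsBoundedSolution G δ v) (x : Space d) :
    Tendsto (fun i => w i x) l (𝓝 (v x)) := by
  rw [Metric.tendsto_nhds]
  intro ε hε
  obtain ⟨β, hβ, hβ1, hβε⟩ : ∃ β > 0, β ≤ 1 ∧ Λ * β / δ + β * bracket x < ε := by
    have t : Tendsto (fun β : ℝ => Λ * β / δ + β * bracket x) (𝓝[>] 0)
        (𝓝 (Λ * 0 / δ + 0 * bracket x)) :=
      (Continuous.tendsto (by fun_prop) 0).mono_left nhdsWithin_le_nhds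
    obtain ⟨β, h1, h2⟩ := ((t.eventually_lt_const (by simpa using hε)).and
      (Ioc_mem_nhdsGT (zero_lt_one' ℝ))).exists
    exact ⟨β, h2.1, h2.2, h1⟩
  -- Beyond this radius the crude bound on the two Hamiltonians is already below the permitted error
  -- `δ * β * bracket y`, so only a compact set of points matters.
  set R := 2 * (C + Λ * (2 * K + 1)) / (δ * β) with hR
  have hδβ : 0 < δ * β := by positivity
  filter_upwards [eventually_abs_sub_le_on_compact hF hG ha hlim R hδβ] with i hi
  rw [Real.dist_eq]
  refine ((hF i).abs_sub_le_of_error hG hδ hβ hβ1 (fun q y hq => ?_) (hw i) hv x).trans_lt hβε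
  rcases le_or_gt ‖y‖ R with h | h
  · refine (hi q y hq h).trans ?_
    have : 1 ≤ bracket y := by
      unfold bracket
      rw [Real.one_le_sqrt]; nlinarith [sq_nonneg ‖y - 0‖]
    nlinarith
  · rw [hR, div_lt_iff₀' hδβ] at h
    have h1 := (hF i).abs_le_of_norm_le (q := q) (x := y) (by linarith)
    have h2 := hG.abs_le_of_norm_le (q := q) (x := y) (by linarith)
    have h3 := mul_le_mul_of_nonneg_left (norm_le_bracket y) hδβ.le
    have h4 := abs_sub (F i q y) (G q y)
    linarith

end IsCoerciveHamiltonian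

/-! ### Measurability and translation of solutions -/

/-- A real function that is continuous with respect to a measurable map into a second countable
space is measurable. -/
theorem measurable_of_tendsto_comap {Ω X : Type*} [MeasurableSpace Ω] [TopologicalSpace X]
    [MeasurableSpace X] [BorelSpace X] {Φ : Ω → X} (hΦ : Measurable Φ) {f : Ω → ℝ}
    (hf : ∀ ω, Tendsto f (comap Φ (𝓝 (Φ ω))) (𝓝 (f ω))) : Measurable f := by
  refine measurable_of_isOpen fun U hU => ?_
  let _ : TopologicalSpace Ω := TopologicalSpace.induced Φ inferInstance
  have hfc : Continuous f := continuous_iff_continuousAt.2 fun ω => by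
    rw [ContinuousAt, nhds_induced]; exact hf ω
  obtain ⟨W, hW, hWU⟩ := isOpen_induced_iff.1 (hU.preimage hfc)
  rw [← hWU]
  exact hΦ hW.measurableSet

/-- By stability, the solution is a continuous function of the values of the Hamiltonian on a
countable dense set, and those values are random variables. The uncountable Perron supremum is never
examined. -/
theorem measurable_solution {d : ℕ} {Ω : Type*} [MeasurableSpace Ω]
    {F : Ω → Space d → Space d → ℝ} {C K Λ δ : ℝ} (hF : ∀ ω, IsCoerciveHamiltonian (F ω) C K Λ)
    (hmeas : ∀ q x, Measurable fun ω => F ω q x) (hδ : 0 < δ) {w : Ω → Space d → ℝ}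
    (hw : ∀ ω, IsBoundedSolution (F ω) δ (w ω)) (x : Space d) : Measurable fun ω => w ω x := by
  set a := TopologicalSpace.denseSeq (Space d × Space d)
  refine measurable_of_tendsto_comap (X := ℕ → ℝ) (Φ := fun ω n => F ω (a n).1 (a n).2)
    (measurable_pi_lambda _ fun n => hmeas _ _) fun ω => ?_
  refine IsCoerciveHamiltonian.tendsto_solution (F := F) hF (hF ω) hδ
    (TopologicalSpace.denseRange_denseSeq _) (fun n => ?_) hw (hw ω) x
  exact ((continuous_apply (A := fun _ : ℕ => ℝ) n).tendsto _).comp tendsto_comap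

theorem IsBoundedSolution.translate {d : ℕ} {G : Space d → Space d → ℝ} {δ : ℝ}
    {v : Space d → ℝ} (hv : IsBoundedSolution G δ v) (z : Space d) :
    IsBoundedSolution (fun q x => G q (x + z)) δ (fun x => v (x + z)) := by
  have hgrad : ∀ φ : Space d → ℝ, ∀ x, gradient (fun y => φ (y - z)) (x + z) = gradient φ x := by
    intro φ x
    rw [gradient, gradient, fderiv_comp_sub, add_sub_cancel_right]
  have hloc : ∀ x, Tendsto (fun y : Space d => y - z) (𝓝 (x + z)) (𝓝 x) := fun x => by
    have := (continuous_sub_right z).tendsto (x + z)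
    rwa [add_sub_cancel_right] at this
  refine ⟨hv.continuous.comp (by fun_prop), ?_, fun φ hφ x hx => ?_, fun φ hφ x hx => ?_⟩
  · obtain ⟨C, hC⟩ := hv.bounded
    exact ⟨C, fun x => hC _⟩
  · rw [← hgrad]
    refine hv.sub (fun y => φ (y - z)) (hφ.comp (contDiff_id.sub contDiff_const)) (x + z) ?_
    filter_upwards [(hloc x).eventually hx] with y hy
    simpa using hy
  · rw [← hgrad]
    refine hv.super (fun y => φ (y - z)) (hφ.comp (contDiff_id.sub contDiff_const)) (x + z) ?_
    filter_upwards [(hloc x).eventually hx] with y hy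
    simpa using hy

/-! ### Maximal ergodic theorem and ergodicity -/

section ergodic

variable {Ω : Type*}

/-- The maximum of the first `n` partial ergodic sums of `f` (and of `0`). -/
noncomputable def maxErgodicSum (T : Ω → Ω) (f : Ω → ℝ) : ℕ → Ω → ℝ
  | 0, _ => 0
  | n + 1, ω => max 0 (f ω + maxErgodicSum T f n (T ω))

variable {T : Ω → Ω} {f : Ω → ℝ}

theorem maxErgodicSum_nonneg (n : ℕ) (ω : Ω) : 0 ≤ maxErgodicSum T f n ω := by
  cases n
  · exact le_rfl
  · exact le_max_left _ _

theorem maxErgodicSum_le_succ (n : ℕ) (ω : Ω) :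
    maxErgodicSum T f n ω ≤ maxErgodicSum T f (n + 1) ω := by
  induction n generalizing ω with
  | zero => exact maxErgodicSum_nonneg _ _
  | succ n ih =>
    simp only [maxErgodicSum] at ih ⊢
    exact max_le_max le_rfl (add_le_add le_rfl (ih _))

theorem sum_le_maxErgodicSum (n : ℕ) (ω : Ω) :
    ∑ k ∈ Finset.range n, f (T^[k] ω) ≤ maxErgodicSum T f n ω := by
  induction n generalizing ω with
  | zero => simp [maxErgodicSum]
  | succ n ih =>
    rw [Finset.sum_range_succ', add_comm]
    exact (add_le_add le_rfl (ih (T ω))).trans (le_max_right _ _)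

variable [MeasurableSpace Ω] {P : Measure Ω}

theorem measurable_maxErgodicSum (hT : Measurable T) (hf : Measurable f) (n : ℕ) :
    Measurable (maxErgodicSum T f n) := by
  induction n with
  | zero => exact measurable_const
  | succ n ih => exact measurable_const.max (hf.add (ih.comp hT))

theorem integrable_maxErgodicSum (hT : MeasurePreserving T P P) (hf : Integrable f P) (n : ℕ) :
    Integrable (maxErgodicSum T f n) P := by
  induction n with
  | zero => exact integrable_zero _ _ _
  | succ n ih =>
    exact (integrable_zero Ω ℝ P).sup (hf.add (hT.integrable_comp_of_integrable ih))

/-- The maximal ergodic theorem. -/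
theorem setIntegral_maxErgodicSum_pos_nonneg (hT : MeasurePreserving T P P) (hfm : Measurable f)
    (hf : Integrable f P) (n : ℕ) :
    0 ≤ ∫ ω in {ω | 0 < maxErgodicSum T f (n + 1) ω}, f ω ∂P := by
  set A := {ω | 0 < maxErgodicSum T f (n + 1) ω} with hA
  have hAm : MeasurableSet A :=
    measurableSet_lt measurable_const (measurable_maxErgodicSum hT.measurable hfm _)
  have hi := integrable_maxErgodicSum hT hf
  have hiT : Integrable (fun ω => maxErgodicSum T f n (T ω)) P :=
    hT.integrable_comp_of_integrable (hi n)
  have hmp : ∫ ω, maxErgodicSum T f n (T ω) ∂P = ∫ ω, maxErgodicSum T f n ω ∂P :=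
    hT.hasLaw.integral_comp (hi n).aestronglyMeasurable
  have hmono : ∫ ω, maxErgodicSum T f n ω ∂P ≤ ∫ ω, maxErgodicSum T f (n + 1) ω ∂P :=
    integral_mono (hi n) (hi _) (maxErgodicSum_le_succ n)
  -- Garsia's argument: on `A` the recursion gives equality of the integrands, and off `A` the left
  -- one is nonpositive. The left integral is nonnegative by invariance of `P` and monotonicity in
  -- `n`.
  have hle : ∫ ω, (maxErgodicSum T f (n + 1) ω - maxErgodicSum T f n (T ω)) ∂P ≤
      ∫ ω, A.indicator f ω ∂P := by
    refine integral_mono ((hi _).sub hiT) (hf.indicator hAm) fun ω => ?_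
    by_cases hω : ω ∈ A
    · rw [indicator_of_mem hω]
      have h1 : 0 < max 0 (f ω + maxErgodicSum T f n (T ω)) := hω
      have h2 : maxErgodicSum T f (n + 1) ω = f ω + maxErgodicSum T f n (T ω) := by
        refine max_eq_right ?_
        by_contra! h
        rw [max_eq_left h.le] at h1
        exact lt_irrefl _ h1
      simp only [h2]; linarith
    · rw [indicator_of_notMem hω]
      have h1 : maxErgodicSum T f (n + 1) ω ≤ 0 := not_lt.1 hω
      have h2 := maxErgodicSum_nonneg (T := T) (f := f) n (T ω)
      simp only; linarith
  rw [integral_sub (hi _) hiT, integral_indicator hAm] at hle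
  linarith

/-- If bounded nonnegative functions tend to `0` almost surely, then their ergodic averages are
eventually small, uniformly in the length of the averages. -/
theorem ae_exists_forall_sum_le [IsProbabilityMeasure P] (hT : MeasurePreserving T P P)
    {g : ℕ → Ω → ℝ} {B : ℝ} (hg : ∀ N, Measurable (g N)) (hg0 : ∀ N ω, 0 ≤ g N ω)
    (hgB : ∀ N ω, g N ω ≤ B) (hlim : ∀ᵐ ω ∂P, Tendsto (fun N => g N ω) atTop (𝓝 0)) :
    ∀ᵐ ω ∂P, ∀ c : ℝ, 0 < c → ∃ N, ∀ n : ℕ, ∑ k ∈ Finset.range n, g N (T^[k] ω) ≤ n * c := by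
  have hgi : ∀ N, Integrable (g N) P := fun N =>
    Integrable.of_bound (hg N).aestronglyMeasurable B
      (Eventually.of_forall fun ω => by rw [Real.norm_of_nonneg (hg0 N ω)]; exact hgB N ω)
  have hint : Tendsto (fun N => ∫ ω, g N ω ∂P) atTop (𝓝 0) := by
    have := tendsto_integral_of_dominated_convergence (F := g) (f := fun _ => (0 : ℝ)) (μ := P)
      (fun _ => B) (fun N => (hg N).aestronglyMeasurable) (integrable_const B)
      (fun N => Eventually.of_forall fun ω => by
        rw [Real.norm_of_nonneg (hg0 N ω)]; exact hgB N ω) hlim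
    simpa using this
  have key : ∀ c : ℝ, 0 < c →
      ∀ᵐ ω ∂P, ∃ N, ∀ n : ℕ, ∑ k ∈ Finset.range n, g N (T^[k] ω) ≤ n * c := by
    intro c hc
    -- The bad set, where every `N` fails, does not depend on `N`. For each `N` the maximal
    -- inequality for `g N - c` bounds its probability, and the bound tends to `0`.
    have hbound : ∀ N, P {ω | ¬ ∃ N, ∀ n : ℕ, ∑ k ∈ Finset.range n, g N (T^[k] ω) ≤ n * c} ≤
        ENNReal.ofReal ((∫ ω, g N ω ∂P) / c) := by
      intro N
      set h : Ω → ℝ := fun ω => g N ω - c with hh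
      have hhm : Measurable h := (hg N).sub measurable_const
      have hhi : Integrable h P := (hgi N).sub (integrable_const c)
      set A : ℕ → Set Ω := fun n => {ω | 0 < maxErgodicSum T h (n + 1) ω} with hA
      have hAm : ∀ n, MeasurableSet (A n) := fun n =>
        measurableSet_lt measurable_const (measurable_maxErgodicSum hT.measurable hhm _)
      have hAmono : Monotone A := monotone_nat_of_le_succ fun n ω hω =>
        lt_of_lt_of_le hω (maxErgodicSum_le_succ _ _)
      have hsub : {ω | ¬ ∃ N, ∀ n : ℕ, ∑ k ∈ Finset.range n, g N (T^[k] ω) ≤ n * c} ⊆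
          ⋃ n, A n := by
        intro ω hω
        simp only [mem_ofPred_eq, not_exists, not_forall, not_le] at hω
        obtain ⟨n, hn⟩ := hω N
        refine mem_iUnion.2 ⟨n, ?_⟩
        have h1 : ∑ k ∈ Finset.range n, h (T^[k] ω) =
            ∑ k ∈ Finset.range n, g N (T^[k] ω) - n * c := by
          simp [hh, Finset.sum_sub_distrib]
        have h2 := sum_le_maxErgodicSum (T := T) (f := h) n ω
        have h3 := maxErgodicSum_le_succ (T := T) (f := h) n ω
        show 0 < maxErgodicSum T h (n + 1) ω
        linarith
      refine (measure_mono hsub).trans ?_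
      rw [hAmono.measure_iUnion]
      refine iSup_le fun n => ?_
      rw [← ENNReal.ofReal_toReal (measure_ne_top P (A n))]
      refine ENNReal.ofReal_le_ofReal ?_
      rw [le_div_iff₀ hc]
      have h1 := setIntegral_maxErgodicSum_pos_nonneg hT hhm hhi n
      have h2 : ∫ ω in A n, h ω ∂P = ∫ ω in A n, g N ω ∂P - P.real (A n) * c := by
        rw [integral_sub (hgi N).integrableOn (integrable_const c).integrableOn,
          setIntegral_const, smul_eq_mul]
      have h3 : ∫ ω in A n, g N ω ∂P ≤ ∫ ω, g N ω ∂P :=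
        setIntegral_le_integral (hgi N) (Eventually.of_forall (hg0 N))
      have h4 : (P (A n)).toReal = P.real (A n) := rfl
      rw [h4]
      change 0 ≤ ∫ ω in A n, h ω ∂P at h1
      linarith
    have ht : Tendsto (fun N => ENNReal.ofReal ((∫ ω, g N ω ∂P) / c)) atTop (𝓝 0) := by
      have := ENNReal.tendsto_ofReal (hint.div_const c)
      simpa using this
    exact le_antisymm (ge_of_tendsto' ht hbound) bot_le
  have key2 : ∀ᵐ ω ∂P, ∀ m : ℕ, ∃ N, ∀ n : ℕ,
      ∑ k ∈ Finset.range n, g N (T^[k] ω) ≤ n * (1 / ((m : ℝ) + 1)) :=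
    ae_all_iff.2 fun m => key _ Nat.one_div_pos_of_nat
  filter_upwards [key2] with ω hω c hc
  obtain ⟨m, hm⟩ := exists_nat_one_div_lt hc
  obtain ⟨N, hN⟩ := hω m
  exact ⟨N, fun n => (hN n).trans (mul_le_mul_of_nonneg_left hm.le (Nat.cast_nonneg n))⟩

end ergodic

/-- Invariant random variables are almost surely constant. -/
theorem IsErgodicGroup.ae_eq_const {d : ℕ} {Ω : Type*} [MeasurableSpace Ω] {P : Measure Ω}
    [IsProbabilityMeasure P] {τ : Space d → Ω → Ω} (hτ : IsErgodicGroup P τ) {f : Ω → ℝ}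
    (hf : Measurable f) (hinv : ∀ y ω, f (τ y ω) = f ω) : ∃ c, ∀ᵐ ω ∂P, f ω = c := by
  refine exists_eventuallyEq_const_of_forall_separating (l := ae P) (β := ℝ) MeasurableSet
    fun U hU => ?_
  have hUm : MeasurableSet (f ⁻¹' U) := hf hU
  have himg : ∀ y, τ y '' (f ⁻¹' U) = f ⁻¹' U := by
    intro y
    ext ω
    constructor
    · rintro ⟨ω', h, rfl⟩
      rw [mem_preimage, hinv]; exact h
    · intro h
      refine ⟨τ (-y) ω, by rw [mem_preimage, hinv]; exact h, ?_⟩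
      rw [← hτ.add, add_neg_cancel, hτ.zero]
  rcases hτ.ergodic _ hUm himg with h | h
  · right
    exact measure_eq_zero_iff_ae_notMem.1 h
  · left
    exact (prob_compl_eq_zero_iff hUm).2 h

/-! ### The random equation: well-posedness, stationarity, estimates -/

theorem isMacroscopicSolution_iff {d : ℕ} {F : Space d → Space d → ℝ} {p : Space d} {δ : ℝ}
    {v : Space d → ℝ} :
    IsMacroscopicSolution F p δ v ↔ IsBoundedSolution (fun q y => F (p + q) y) δ v :=
  ⟨fun h => ⟨h.1, h.2, h.3, h.4⟩, fun h => ⟨h.1, h.2, h.3, h.4⟩⟩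

namespace IsHamiltonian

variable {d : ℕ} {Ω : Type*} [MeasurableSpace Ω] {τ : Space d → Ω → Ω}
  {H : Space d → Space d → Ω → ℝ}

theorem continuous (hH : IsHamiltonian τ H) (ω : Ω) :
    Continuous fun z : Space d × Space d => H z.1 z.2 ω := by
  refine continuous_iff_continuousAt.2 fun z => ?_
  obtain ⟨C, hC, h⟩ := hH.lipschitz (‖z.1‖ + 1) (by positivity)
  rw [ContinuousAt, tendsto_iff_norm_sub_tendsto_zero]
  have ht : Tendsto (fun w : Space d × Space d => C * (‖w.1 - z.1‖ + ‖w.2 - z.2‖)) (𝓝 z)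
      (𝓝 (C * (‖z.1 - z.1‖ + ‖z.2 - z.2‖))) := Continuous.tendsto (by fun_prop) z
  simp only [sub_self, norm_zero, add_zero, mul_zero] at ht
  refine squeeze_zero' (Eventually.of_forall fun _ => norm_nonneg _) ?_ ht
  have hn : ∀ᶠ w : Space d × Space d in 𝓝 z, ‖w.1‖ < ‖z.1‖ + 1 :=
    (Continuous.tendsto (by fun_prop) z).eventually_lt_const (lt_add_one ‖z.1‖)
  filter_upwards [hn] with w hw
  exact h _ (by simpa using hw) _ (by simp) _ _ _

/-- The standing hypotheses in quantitative form, uniformly for bounded momenta. -/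
theorem exists_isCoerciveHamiltonian (hH : IsHamiltonian τ H) (ρ : ℝ) :
    ∃ C K Λ, ∀ p, ‖p‖ ≤ ρ → ∀ ω,
      IsCoerciveHamiltonian (fun q y => H (p + q) y ω) C K Λ := by
  obtain ⟨C, -, hC⟩ := hH.bounded (|ρ| + 1) (by positivity)
  -- The level `C + 1` makes the coercivity strict; adding `|ρ|` below passes from `p + q` to `q`.
  obtain ⟨R, hR⟩ := hH.coercive (C + 1)
  set K := max 1 (R + |ρ|) with hK
  have hK1 : 1 ≤ K := le_max_left _ _
  obtain ⟨Λ, hΛ, h⟩ := hH.lipschitz (2 * K + 1 + |ρ| + 1) (by positivity)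
  refine ⟨C, K, Λ, fun p hp ω => ⟨by positivity, hΛ.le, ?_, fun x => ?_, fun q x hq => ?_,
    fun q₁ q₂ x y h₁ h₂ => ?_⟩⟩
  · exact (hH.continuous ω).comp
      (show Continuous fun z : Space d × Space d => (p + z.1, z.2) by fun_prop)
  · refine hC _ ?_ _ _
    rw [add_zero, mem_ball_zero_iff]
    linarith [le_abs_self ρ]
  · have h1 : R + |ρ| ≤ ‖q‖ := (le_max_right _ _).trans hq
    have h2 : ‖q‖ ≤ ‖p + q‖ + ‖p‖ := by
      simpa using norm_sub_le (p + q) p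
    have := hR (p + q) (by linarith [le_abs_self ρ]) x ω
    linarith
  · have hb : ∀ q : Space d, ‖q‖ ≤ 2 * K + 1 →
        p + q ∈ Metric.ball (0 : Space d) (2 * K + 1 + |ρ| + 1) := fun q hq => by
      rw [mem_ball_zero_iff]
      linarith [norm_add_le p q, le_abs_self ρ]
    have := h _ (hb q₁ h₁) _ (hb q₂ h₂) x y ω
    rwa [add_sub_add_left_eq_sub] at this

theorem isBoundedSolution (hH : IsHamiltonian τ H) (p : Space d) {δ : ℝ} (hδ : 0 < δ) (ω : Ω) :
    IsBoundedSolution (fun q y => H (p + q) y ω) δ (macroscopicSolution H p δ ω) := by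
  obtain ⟨C, K, Λ, h⟩ := hH.exists_isCoerciveHamiltonian ‖p‖
  obtain ⟨v, hv⟩ := (h p le_rfl ω).exists_solution hδ
  have hex : ∃ v, IsMacroscopicSolution (fun q y => H q y ω) p δ v :=
    ⟨v, isMacroscopicSolution_iff.2 hv⟩
  rw [macroscopicSolution, dif_pos hex]
  exact isMacroscopicSolution_iff.1 hex.choose_spec

theorem solution_unique (hH : IsHamiltonian τ H) (p : Space d) {δ : ℝ} (hδ : 0 < δ) (ω : Ω)
    {v : Space d → ℝ} (hv : IsBoundedSolution (fun q y => H (p + q) y ω) δ v) :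
    v = macroscopicSolution H p δ ω := by
  obtain ⟨C, K, Λ, h⟩ := hH.exists_isCoerciveHamiltonian ‖p‖
  exact (h p le_rfl ω).solution_unique hδ hv (hH.isBoundedSolution p hδ ω)

theorem existsUnique_isMacroscopicSolution (hH : IsHamiltonian τ H) (p : Space d) {δ : ℝ}
    (hδ : 0 < δ) (ω : Ω) : ∃! v, IsMacroscopicSolution (fun q y => H q y ω) p δ v :=
  ⟨_, isMacroscopicSolution_iff.2 (hH.isBoundedSolution p hδ ω), fun _ hv =>
    hH.solution_unique p hδ ω (isMacroscopicSolution_iff.1 hv)⟩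

/-- By stationarity the translate by `z` solves the equation at `τ z ω`, and the solution there is
unique. -/
theorem macroscopicSolution_shift (hH : IsHamiltonian τ H) (p : Space d) {δ : ℝ} (hδ : 0 < δ)
    (ω : Ω) (z x : Space d) :
    macroscopicSolution H p δ (τ z ω) x = macroscopicSolution H p δ ω (x + z) := by
  have h := (hH.isBoundedSolution p hδ ω).translate z
  simp only [hH.stationary] at h
  exact (congrFun (hH.solution_unique p hδ (τ z ω) h) x).symm

theorem measurable_macroscopicSolution (hH : IsHamiltonian τ H) (p : Space d) {δ : ℝ}
    (hδ : 0 < δ) (x : Space d) : Measurable fun ω => macroscopicSolution H p δ ω x := by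
  obtain ⟨C, K, Λ, h⟩ := hH.exists_isCoerciveHamiltonian ‖p‖
  exact measurable_solution (h p le_rfl) (fun q y => hH.measurable (p + q) y) hδ
    (hH.isBoundedSolution p hδ) x

/-- Uniform estimates on `v^δ` for bounded momenta. -/
theorem exists_estimates (hH : IsHamiltonian τ H) (ρ : ℝ) : ∃ C K Λ : ℝ, 0 ≤ C ∧ 0 ≤ K ∧ 0 ≤ Λ ∧
    (∀ p, ‖p‖ ≤ ρ → ∀ δ, 0 < δ → ∀ ω x, |δ * macroscopicSolution H p δ ω x| ≤ C) ∧
    (∀ p, ‖p‖ ≤ ρ → ∀ δ, 0 < δ → ∀ ω x y,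
      |macroscopicSolution H p δ ω x - macroscopicSolution H p δ ω y| ≤ K * ‖x - y‖) ∧
    (∀ p p', ‖p‖ ≤ ρ → ‖p'‖ ≤ ρ → ∀ δ, 0 < δ → ∀ ω x,
      |δ * macroscopicSolution H p δ ω x - δ * macroscopicSolution H p' δ ω x| ≤
        Λ * ‖p - p'‖) ∧
    (∀ p, ‖p‖ ≤ ρ → ∀ δ η, 0 < δ → 0 < η → ∀ ω x,
      |δ * macroscopicSolution H p δ ω x - η * macroscopicSolution H p η ω x| ≤
        2 * C * |δ - η| / η) := by
  obtain ⟨C, K, Λ, h⟩ := hH.exists_isCoerciveHamiltonian ρ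
  -- The signs of the constants are read off from an actual `p` and `ω`; without one, all the
  -- estimates are vacuous.
  by_cases hne : (∃ p : Space d, ‖p‖ ≤ ρ) ∧ Nonempty Ω
  · obtain ⟨⟨p₀, hp₀⟩, ⟨ω₀⟩⟩ := hne
    have h0 := h p₀ hp₀ ω₀
    obtain ⟨Λ', hΛ', hlip⟩ := hH.lipschitz (ρ + 2 * K + 1)
      (by have := h0.K_pos; have := (norm_nonneg p₀).trans hp₀; positivity)
    refine ⟨C, K, Λ', (abs_nonneg _).trans (h0.bound 0), h0.K_pos.le, hΛ'.le,
      fun p hp δ hδ ω x => (h p hp ω).abs_solution_le hδ (hH.isBoundedSolution p hδ ω) x,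
      fun p hp δ hδ ω x y => (h p hp ω).abs_sub_solution_le hδ (hH.isBoundedSolution p hδ ω) x y,
      fun p p' hp hp' δ hδ ω x => ?_,
      fun p hp δ η hδ hη ω x => (h p hp ω).abs_discount_mul_sub_le hδ hη
        (hH.isBoundedSolution p hη ω) (hH.isBoundedSolution p hδ ω) x⟩
    have := (h p hp ω).abs_sub_le_of_uniform (h p' hp' ω) hδ (e := Λ' * ‖p - p'‖)
      (fun q y hq => by
        have := hlip (p + q) (by rw [mem_ball_zero_iff]; linarith [norm_add_le p q])
          (p' + q) (by rw [mem_ball_zero_iff]; linarith [norm_add_le p' q]) y y ω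
        simpa using this)
      (hH.isBoundedSolution p hδ ω) (hH.isBoundedSolution p' hδ ω) x
    rw [← mul_sub, abs_mul, abs_of_pos hδ]
    rwa [le_div_iff₀' hδ] at this
  · refine ⟨0, 0, 0, le_rfl, le_rfl, le_rfl, ?_, ?_, ?_, ?_⟩
    · exact fun p hp _ _ ω => absurd ⟨⟨p, hp⟩, ⟨ω⟩⟩ hne
    · exact fun p hp _ _ ω => absurd ⟨⟨p, hp⟩, ⟨ω⟩⟩ hne
    · exact fun p _ hp _ _ _ ω => absurd ⟨⟨p, hp⟩, ⟨ω⟩⟩ hne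
    · exact fun p hp _ _ _ _ ω => absurd ⟨⟨p, hp⟩, ⟨ω⟩⟩ hne

/-! ### Localization in the momentum -/

/-- A cone in the momentum variable is an admissible convex Hamiltonian. -/
theorem cone {A : ℝ} (hA : 0 < A) (B : ℝ) :
    IsHamiltonian τ (fun (p _ : Space d) (_ : Ω) => A * ‖p‖ + B) where
  measurable _ _ := measurable_const
  stationary _ _ _ _ := rfl
  coercive M := ⟨(M - B) / A, fun p hp _ _ => by
    rw [div_le_iff₀' hA] at hp; linarith⟩
  bounded R hR := ⟨A * R + |B|, by positivity, fun p hp _ _ => by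
    rw [mem_ball_zero_iff] at hp
    refine (abs_add_le _ _).trans ?_
    rw [abs_of_nonneg (by positivity : 0 ≤ A * ‖p‖)]
    gcongr⟩
  lipschitz R _ := ⟨A, hA, fun p₁ _ p₂ _ y₁ y₂ _ => by
    rw [add_sub_add_right_eq_sub, ← mul_sub, abs_mul, abs_of_pos hA]
    gcongr
    exact (abs_norm_sub_norm_le _ _).trans (le_add_of_nonneg_right (norm_nonneg _))⟩

/-- The truncation `max (min H M) (A |p| + B)` of an admissible Hamiltonian is admissible. -/
theorem truncation (hH : IsHamiltonian τ H) {A : ℝ} (hA : 0 < A) (B M : ℝ) :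
    IsHamiltonian τ (fun p y ω => max (min (H p y ω) M) (A * ‖p‖ + B)) where
  measurable p y := ((hH.measurable p y).min measurable_const).max measurable_const
  stationary p y z ω := by rw [hH.stationary]
  coercive N := by
    obtain ⟨R, hR⟩ := (cone (τ := τ) hA B).coercive N
    exact ⟨R, fun p hp y ω => (hR p hp y ω).trans (le_max_right _ _)⟩
  bounded R hR := by
    obtain ⟨C, hC, h⟩ := hH.bounded R hR
    obtain ⟨C', hC', h'⟩ := (cone (τ := τ) hA B).bounded R hR
    refine ⟨C + |M| + C', by positivity, fun p hp y ω => ?_⟩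
    have h1 := abs_le.1 (h p hp y ω)
    have h2 := abs_le.1 (h' p hp y ω)
    have h3 := neg_abs_le M
    have h4 := abs_nonneg M
    rw [abs_le]
    constructor
    · exact le_max_of_le_right (by linarith)
    · exact max_le ((min_le_left _ _).trans (by linarith)) (by linarith)
  lipschitz R hR := by
    obtain ⟨C, hC, h⟩ := hH.lipschitz R hR
    obtain ⟨C', hC', h'⟩ := (cone (τ := τ) hA B).lipschitz R hR
    refine ⟨C + C', by positivity, fun p₁ hp₁ p₂ hp₂ y₁ y₂ ω => ?_⟩
    have h1 := h p₁ hp₁ p₂ hp₂ y₁ y₂ ω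
    have h2 := h' p₁ hp₁ p₂ hp₂ y₁ y₂ ω
    refine (abs_max_sub_max_le_max _ _ _ _).trans ?_
    have h3 := abs_min_sub_min_le_max (H p₁ y₁ ω) M (H p₂ y₂ ω) M
    rw [sub_self, abs_zero, max_eq_left (abs_nonneg _)] at h3
    have h4 : 0 ≤ ‖p₁ - p₂‖ + ‖y₁ - y₂‖ := by positivity
    rw [add_mul]
    refine max_le ?_ ?_
    · have : 0 ≤ C' * (‖p₁ - p₂‖ + ‖y₁ - y₂‖) := by positivity
      linarith
    · have : 0 ≤ C * (‖p₁ - p₂‖ + ‖y₁ - y₂‖) := by positivity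
      linarith

/-- For bounded momenta, `H` can be replaced by a Hamiltonian that is convex outside a ball. -/
theorem exists_isConvexOutsideBall (hH : IsHamiltonian τ H) (ρ : ℝ) :
    ∃ H', IsHamiltonian τ H' ∧ IsConvexOutsideBall τ H' ∧
      ∀ p, ‖p‖ ≤ ρ → ∀ δ, 0 < δ → ∀ ω,
        macroscopicSolution H' p δ ω = macroscopicSolution H p δ ω := by
  obtain ⟨C, K, Λ, h⟩ := hH.exists_isCoerciveHamiltonian ρ
  set R := max 0 (ρ + 2 * K + 1) with hR
  have hR0 : 0 ≤ R := le_max_left _ _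
  obtain ⟨C₁, hC₁, hb⟩ := hH.bounded (R + 1) (by positivity)
  -- `M > C` preserves coercivity above the level `C`, and `M > C₁` leaves `H` untruncated where
  -- `|H| ≤ C₁`.
  set M := max C C₁ + 1 with hM
  have hMC : C < M := (le_max_left C C₁).trans_lt (lt_add_one _)
  have hMC₁ : C₁ < M := (le_max_right C C₁).trans_lt (lt_add_one _)
  have hA : 0 < M + C₁ := by linarith
  -- The cone equals `-C₁` at `|p| = R` and `M` at `|p| = R + 1`: it lies below `H` inside the first
  -- sphere and above the cap `M` outside the second.
  set B := -(M + C₁) * R - C₁ with hB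
  set H' : Space d → Space d → Ω → ℝ := fun p y ω =>
    max (min (H p y ω) M) ((M + C₁) * ‖p‖ + B) with hH'
  have hH'H : IsHamiltonian τ H' := hH.truncation hA B M
  have heq : ∀ p, ‖p‖ ≤ R → ∀ y ω, H' p y ω = H p y ω := by
    intro p hp y ω
    have h1 := abs_le.1 (hb p (by rw [mem_ball_zero_iff]; linarith) y ω)
    have h2 : (M + C₁) * ‖p‖ ≤ (M + C₁) * R := by gcongr
    simp only [hH']
    rw [min_eq_left (by linarith), max_eq_left (by linarith)]
  have hle : ∀ p q : Space d, ‖p‖ ≤ ρ → ‖q‖ ≤ 2 * K + 1 → ‖p + q‖ ≤ R := fun p q hp hq =>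
    (norm_add_le p q).trans (le_trans (by linarith) (le_max_right _ _))
  refine ⟨H', hH'H, ⟨_, cone (τ := τ) hA B, ⟨R + 1, by positivity, fun p hp y ω => ?_⟩,
    fun y ω => ?_⟩, fun p hp δ hδ ω => ?_⟩
  · rw [mem_ball_zero_iff, not_lt] at hp
    have h1 : (M + C₁) * (R + 1) ≤ (M + C₁) * ‖p‖ := by gcongr
    refine (max_eq_right ((min_le_right _ _).trans ?_)).symm
    linarith
  · exact ((convexOn_univ_norm (E := Space d)).smul hA.le).add_const B
  · have hG := h p hp ω
    have hG' : IsCoerciveHamiltonian (fun q y => H' (p + q) y ω) C K Λ := by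
      refine ⟨hG.K_pos, hG.Λ_nonneg, ?_, fun x => ?_, fun q x hq => ?_,
        fun q₁ q₂ x y h₁ h₂ => ?_⟩
      · exact (hH'H.continuous ω).comp
          (show Continuous fun z : Space d × Space d => (p + z.1, z.2) by fun_prop)
      · rw [heq _ (hle p 0 hp (by have := hG.K_pos; rw [norm_zero]; positivity))]
        exact hG.bound x
      · exact lt_max_of_lt_left (lt_min (hG.coercive q x hq) hMC)
      · rw [heq _ (hle p q₁ hp h₁), heq _ (hle p q₂ hp h₂)]
        exact hG.lipschitz q₁ q₂ x y h₁ h₂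
    funext x
    -- Both equations share `C`, `K`, `Λ`, and the estimate compares them only for `|q| ≤ 2 * K`,
    -- where they coincide.
    have := hG'.abs_sub_le_of_uniform hG hδ (e := 0) (fun q y hq => by
      rw [heq _ (hle p q hp (by linarith)), sub_self, abs_zero])
      (hH'H.isBoundedSolution p hδ ω) (hH.isBoundedSolution p hδ ω) x
    rw [zero_div] at this
    exact sub_eq_zero.1 (abs_nonpos_iff.1 this)

end IsHamiltonian

/-! ### The deterministic limit at the origin -/

namespace IsHamiltonian

variable {d : ℕ} {Ω : Type*} [MeasurableSpace Ω] {P : Measure Ω} {τ : Space d → Ω → Ω}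
  {H : Space d → Space d → Ω → ℝ}

/-- Localization in the momentum variable: the limits exist for `H` as soon as they do for all
Hamiltonians that are convex outside a ball. -/
theorem ae_exists_tendsto (hH : IsHamiltonian τ H)
    (hloc : ∀ H' : Space d → Space d → Ω → ℝ, IsHamiltonian τ H' → IsConvexOutsideBall τ H' →
      ∀ᵐ ω ∂P, ∀ p : Space d, ∃ L : ℝ,
        Tendsto (fun δ : ℝ => -(δ * macroscopicSolution H' p δ ω 0)) (𝓝[>] 0) (𝓝 L)) :
    ∀ᵐ ω ∂P, ∀ p : Space d, ∃ L : ℝ,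
      Tendsto (fun δ : ℝ => -(δ * macroscopicSolution H p δ ω 0)) (𝓝[>] 0) (𝓝 L) := by
  choose H' hH' hconv heq using fun n : ℕ => hH.exists_isConvexOutsideBall (n : ℝ)
  have hall := ae_all_iff.2 fun n => hloc (H' n) (hH' n) (hconv n)
  filter_upwards [hall] with ω hω p
  obtain ⟨n, hn⟩ := exists_nat_ge ‖p‖
  obtain ⟨L, hL⟩ := hω n p
  refine ⟨L, hL.congr' ?_⟩
  filter_upwards [self_mem_nhdsWithin] with δ hδ
  rw [heq n p hn δ hδ ω]

theorem tendsto_inv_natCast_nhdsGT : Tendsto (fun n : ℕ => (n : ℝ)⁻¹) atTop (𝓝[>] 0) :=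
  tendsto_inv_atTop_nhdsGT_zero.comp tendsto_natCast_atTop_atTop

/-- Ergodicity is applied to a function invariant at every `ω`, including those where no limit
exists. Both sequences have the same set of limits, so even the default values agree. -/
theorem limUnder_congr_of_tendsto_sub {a b : ℕ → ℝ}
    (h : Tendsto (fun n => a n - b n) atTop (𝓝 0)) : limUnder atTop a = limUnder atTop b := by
  have : ∀ x, Tendsto a atTop (𝓝 x) ↔ Tendsto b atTop (𝓝 x) := fun x =>
    ⟨fun h1 => by simpa using h1.sub h, fun h1 => by simpa using h.add h1⟩
  unfold limUnder lim
  congr 1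
  funext x
  exact propext (this x)

/-- The limit is almost surely deterministic. -/
theorem exists_ae_tendsto_const [IsProbabilityMeasure P] (hτ : IsErgodicGroup P τ)
    (hH : IsHamiltonian τ H) {p : Space d}
    (hlim : ∀ᵐ ω ∂P, ∃ L : ℝ,
      Tendsto (fun δ : ℝ => -(δ * macroscopicSolution H p δ ω 0)) (𝓝[>] 0) (𝓝 L)) :
    ∃ c, ∀ᵐ ω ∂P,
      Tendsto (fun δ : ℝ => -(δ * macroscopicSolution H p δ ω 0)) (𝓝[>] 0) (𝓝 c) := by
  set a : Ω → ℕ → ℝ := fun ω n => -((n : ℝ)⁻¹ * macroscopicSolution H p (n : ℝ)⁻¹ ω 0) with ha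
  have ham : ∀ n, Measurable fun ω => a ω n := by
    intro n
    -- At `n = 0` the factor `(n : ℝ)⁻¹` is `0`, so the term vanishes although the discount is not
    -- positive.
    rcases n.eq_zero_or_pos with rfl | hn
    · simp [ha]
    · exact ((hH.measurable_macroscopicSolution p (by positivity) 0).const_mul _).neg
  obtain ⟨C, K, Λ, -, hK, -, -, hlip, -, -⟩ := hH.exists_estimates ‖p‖
  obtain ⟨c, hc⟩ := hτ.ae_eq_const (f := fun ω => limUnder atTop (a ω))
    (StronglyMeasurable.limUnder fun n => (ham n).stronglyMeasurable).measurable fun y ω => by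
      refine limUnder_congr_of_tendsto_sub ?_
      refine squeeze_zero_norm' (a := fun n : ℕ => (n : ℝ)⁻¹ * (K * ‖y‖)) ?_ ?_
      · filter_upwards [eventually_gt_atTop 0] with n hn
        have hn' : 0 < (n : ℝ)⁻¹ := by positivity
        have h1 := hlip p le_rfl _ hn' ω 0 (0 + y)
        simp only [ha]
        rw [hH.macroscopicSolution_shift p hn' ω y 0, neg_sub_neg, ← mul_sub, norm_mul,
          Real.norm_of_nonneg hn'.le, Real.norm_eq_abs]
        gcongr
        simpa using h1
      · simpa using (tendsto_inv_natCast_nhdsGT.mono_right nhdsWithin_le_nhds).mul_const (K * ‖y‖)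
  refine ⟨c, ?_⟩
  filter_upwards [hc, hlim] with ω h1 ⟨L, hL⟩
  have h2 : Tendsto (a ω) atTop (𝓝 L) := hL.comp tendsto_inv_natCast_nhdsGT
  rw [← h1, h2.limUnder_eq]
  exact hL

theorem effectiveHamiltonian_eq [IsProbabilityMeasure P] {p : Space d} {c : ℝ}
    (h : ∀ᵐ ω ∂P,
      Tendsto (fun δ : ℝ => -(δ * macroscopicSolution H p δ ω 0)) (𝓝[>] 0) (𝓝 c)) :
    effectiveHamiltonian P H p = c := by
  have h1 : ∀ᵐ ω ∂P, randomEffectiveHamiltonian H p ω = c := h.mono fun ω hω => hω.limsup_eq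
  have h2 : {α : ℝ | ∀ᵐ ω ∂P, α < randomEffectiveHamiltonian H p ω} = Iio c := by
    ext α
    rw [mem_Iio]
    constructor
    · intro hα
      obtain ⟨ω, h3, h4⟩ := (h1.and hα).exists
      rwa [h3] at h4
    · intro hα
      filter_upwards [h1] with ω hω
      rwa [hω]
  rw [effectiveHamiltonian, h2, csSup_Iio]

/-! ### From the origin to distant points -/

theorem iterate_shift (hτ : IsErgodicGroup P τ) (x : Space d) (k : ℕ) (ω : Ω) :
    (τ x)^[k] ω = τ ((k : ℝ) • x) ω := by
  induction k with
  | zero => simp [hτ.zero]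
  | succ k ih =>
    rw [Function.iterate_succ_apply', ih, ← hτ.add]
    congr 1
    push_cast
    module

/-- In a long run of numbers with small average, one of the last few is small. -/
theorem exists_near_end_le {a : ℕ → ℝ} (ha : ∀ k, 0 ≤ a k) {n : ℕ} {ε : ℝ} (hε : 0 < ε)
    (hε1 : ε ≤ 1) (hn : 0 < n) (hsum : ∑ k ∈ Finset.range n, a k ≤ n * ε ^ 2) :
    ∃ k < n, (n : ℝ) - k ≤ ε * n + 1 ∧ a k ≤ ε := by
  by_contra! hcon
  -- Otherwise the last `n - m ≥ ε * n` terms all exceed `ε`, and their sum exceeds `n * ε ^ 2`. The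
  -- `+ 1` in the statement absorbs the floor.
  set m := ⌊(1 - ε) * n⌋₊ with hm
  have hn' : (0 : ℝ) < n := by exact_mod_cast hn
  have h1 : ∀ k ∈ Finset.Ico m n, ε < a k := by
    intro k hk
    rw [Finset.mem_Ico] at hk
    refine hcon k hk.2 ?_
    have h2 : (1 - ε) * n < m + 1 := Nat.lt_floor_add_one _
    have h3 : (m : ℝ) ≤ k := by exact_mod_cast hk.1
    linarith
  have h : 0 ≤ (1 - ε) * n := mul_nonneg (sub_nonneg.2 hε1) hn'.le
  have hmn : m < n := by
    rw [hm, Nat.floor_lt h]; nlinarith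
  have hmle : (n : ℝ) * ε ≤ n - m := by
    have := Nat.floor_le h
    rw [← hm] at this
    linarith
  have h2 : ∑ k ∈ Finset.Ico m n, ε < ∑ k ∈ Finset.Ico m n, a k :=
    Finset.sum_lt_sum_of_nonempty ⟨m, by simpa using hmn⟩ h1
  have h3 : ∑ k ∈ Finset.Ico m n, a k ≤ ∑ k ∈ Finset.range n, a k :=
    Finset.sum_le_sum_of_subset_of_nonneg (fun k hk => by simp at hk ⊢; exact hk.2)
      fun k _ _ => ha k
  rw [Finset.sum_const, Nat.card_Ico, nsmul_eq_mul, Nat.cast_sub hmn.le] at h2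
  nlinarith

/-- Convergence at the origin spreads to the points `n x`. -/
theorem ae_tendsto_along_direction [IsProbabilityMeasure P] (hτ : IsErgodicGroup P τ)
    (hH : IsHamiltonian τ H) {p : Space d} {c : ℝ}
    (hlim : ∀ᵐ ω ∂P,
      Tendsto (fun δ : ℝ => -(δ * macroscopicSolution H p δ ω 0)) (𝓝[>] 0) (𝓝 c))
    (x : Space d) :
    ∀ᵐ ω ∂P, Tendsto (fun n : ℕ => (n : ℝ)⁻¹ * macroscopicSolution H p (n : ℝ)⁻¹ ω ((n : ℝ) • x))
      atTop (𝓝 (-c)) := by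
  obtain ⟨C, K, Λ, hC, hK, -, hbd, hlip, -, -⟩ := hH.exists_estimates ‖p‖
  set a : ℕ → Ω → Space d → ℝ := fun n ω y =>
    |(n : ℝ)⁻¹ * macroscopicSolution H p (n : ℝ)⁻¹ ω y + c| with ha
  have ha0 : ∀ n ω y, 0 ≤ a n ω y := fun _ _ _ => abs_nonneg _
  have hab : ∀ n ω y, a n ω y ≤ C + |c| := by
    intro n ω y
    refine (abs_add_le _ _).trans (add_le_add_left ?_ _)
    rcases n.eq_zero_or_pos with rfl | hn
    · simpa using hC
    · exact hbd p le_rfl _ (by positivity) ω y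
  have ham : ∀ n y, Measurable fun ω => a n ω y := by
    intro n y
    rcases n.eq_zero_or_pos with rfl | hn
    · simp [ha]
    · have := (((hH.measurable_macroscopicSolution p (δ := (n : ℝ)⁻¹) (by positivity)
        y).const_mul (n : ℝ)⁻¹).add_const c)
      exact this.norm
  have hshift : ∀ n, 0 < n → ∀ ω z, a n (τ z ω) 0 = a n ω z := by
    intro n hn ω z
    simp only [ha]
    rw [hH.macroscopicSolution_shift p (by positivity), zero_add]
  have halip : ∀ n, 0 < n → ∀ ω y z, a n ω y ≤ a n ω z + (n : ℝ)⁻¹ * (K * ‖y - z‖) := by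
    intro n hn ω y z
    have hn' : 0 < (n : ℝ)⁻¹ := by positivity
    have h1 := mul_le_mul_of_nonneg_left (hlip p le_rfl _ hn' ω y z) hn'.le
    rw [← abs_of_pos hn', ← abs_mul, abs_of_pos hn'] at h1
    have h2 := abs_sub_abs_le_abs_sub ((n : ℝ)⁻¹ * macroscopicSolution H p (n : ℝ)⁻¹ ω y + c)
      ((n : ℝ)⁻¹ * macroscopicSolution H p (n : ℝ)⁻¹ ω z + c)
    rw [add_sub_add_right_eq_sub, ← mul_sub] at h2
    simp only [ha]
    linarith
  -- The index of `a n` and the length of the orbit are the same `n`; the supremum over the tail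
  -- provides one function that dominates `a n` for all `n ≥ N` at once.
  set g : ℕ → Ω → ℝ := fun N ω => ⨆ n, a (N + n) ω 0 with hg
  have hbdd : ∀ N ω, BddAbove (range fun n => a (N + n) ω 0) := fun N ω =>
    ⟨C + |c|, by rintro _ ⟨n, rfl⟩; exact hab _ _ _⟩
  have hag : ∀ N n ω, N ≤ n → a n ω 0 ≤ g N ω := by
    intro N n ω hNn
    have := le_ciSup (hbdd N ω) (n - N)
    rwa [Nat.add_sub_cancel' hNn] at this
  have hglim : ∀ᵐ ω ∂P, Tendsto (fun N => g N ω) atTop (𝓝 0) := by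
    filter_upwards [hlim] with ω hω
    have h1 : Tendsto (fun n => a n ω 0) atTop (𝓝 0) := by
      have h2 := ((hω.comp tendsto_inv_natCast_nhdsGT).sub_const c).norm
      rw [sub_self, norm_zero] at h2
      refine h2.congr fun n => ?_
      simp only [ha, Function.comp_apply, Real.norm_eq_abs]
      rw [← abs_neg]
      congr 1
      ring
    rw [Metric.tendsto_atTop] at h1 ⊢
    intro ε hε
    obtain ⟨N, hN⟩ := h1 (ε / 2) (by positivity)
    refine ⟨N, fun n hn => ?_⟩
    have h2 : g n ω ≤ ε / 2 := ciSup_le fun k => by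
      have := hN (n + k) (by omega)
      rw [Real.dist_eq, sub_zero] at this
      exact (le_abs_self _).trans this.le
    have h3 : 0 ≤ g n ω := (ha0 n ω 0).trans (hag n n ω le_rfl)
    rw [Real.dist_eq, sub_zero, abs_of_nonneg h3]
    linarith
  have herg := ae_exists_forall_sum_le (hτ.measurePreserving x) (g := g) (B := C + |c|)
    (fun N => Measurable.iSup fun n => ham _ _)
    (fun N ω => (ha0 N ω 0).trans (hag N N ω le_rfl))
    (fun N ω => ciSup_le fun n => hab _ _ _) hglim
  filter_upwards [herg] with ω hω
  suffices hs : Tendsto (fun n : ℕ => a n ω ((n : ℝ) • x)) atTop (𝓝 0) by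
    rw [tendsto_iff_norm_sub_tendsto_zero]
    refine hs.congr fun n => ?_
    simp only [ha, Real.norm_eq_abs, sub_neg_eq_add]
  rw [Metric.tendsto_nhds]
  intro η hη
  obtain ⟨ε, hε, hε1, hεη⟩ : ∃ ε > 0, ε ≤ 1 ∧ ε + K * ‖x‖ * (2 * ε) < η := by
    have t : Tendsto (fun ε : ℝ => ε + K * ‖x‖ * (2 * ε)) (𝓝[>] 0)
        (𝓝 (0 + K * ‖x‖ * (2 * 0))) :=
      (Continuous.tendsto (by fun_prop) 0).mono_left nhdsWithin_le_nhds
    obtain ⟨ε, h1, h2⟩ := ((t.eventually_lt_const (by simpa using hη)).and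
      (Ioc_mem_nhdsGT (zero_lt_one' ℝ))).exists
    exact ⟨ε, h2.1, h2.2, h1⟩
  obtain ⟨N, hN⟩ := hω (ε ^ 2) (by positivity)
  have hinv : ∀ᶠ n : ℕ in atTop, (n : ℝ)⁻¹ < ε :=
    (tendsto_inv_natCast_nhdsGT.mono_right nhdsWithin_le_nhds).eventually_lt_const hε
  filter_upwards [eventually_ge_atTop N, eventually_gt_atTop 0, hinv] with n hnN hn hnε
  have hn' : (0 : ℝ) < n := by exact_mod_cast hn
  -- By the shift rule, `a n ω (k x)` is `a n` at the origin for the `k`-th iterate of `τ x`, hence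
  -- at most `g N` there.
  obtain ⟨k, hkn, hk1, hk2⟩ := exists_near_end_le (a := fun k => a n ω ((k : ℝ) • x))
    (fun k => ha0 _ _ _) hε hε1 hn (by
      refine le_trans (Finset.sum_le_sum fun k _ => ?_) (hN n)
      rw [iterate_shift hτ, ← hshift n hn]
      exact hag N n _ hnN)
  have hkn' : (k : ℝ) ≤ n := by exact_mod_cast hkn.le
  have h1 := halip n hn ω ((n : ℝ) • x) ((k : ℝ) • x)
  rw [← sub_smul, norm_smul, Real.norm_of_nonneg (sub_nonneg.2 hkn')] at h1
  have h2 : (n : ℝ)⁻¹ * (K * (((n : ℝ) - k) * ‖x‖)) ≤ K * ‖x‖ * (2 * ε) := by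
    calc (n : ℝ)⁻¹ * (K * (((n : ℝ) - k) * ‖x‖))
        ≤ (n : ℝ)⁻¹ * (K * ((ε * n + 1) * ‖x‖)) := by gcongr
      _ = K * ‖x‖ * (ε + (n : ℝ)⁻¹) := by field_simp
      _ ≤ K * ‖x‖ * (2 * ε) := by gcongr; linarith
  rw [Real.dist_eq, sub_zero, abs_of_nonneg (ha0 _ _ _)]
  linarith

end IsHamiltonian

/-! ### From countable families to all momenta, points and discounts -/

theorem tendsto_iSup_abs_macroscopicSolution {d : ℕ} {Ω : Type*}
    {H : Space d → Space d → Ω → ℝ} {ω : Ω} {p : Space d} {c R : ℝ} (hR : 0 < R)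
    (hev : ∀ ε > 0, ∀ᶠ δ : ℝ in 𝓝[>] 0, ∀ y, ‖y‖ < R / δ →
      |c + δ * macroscopicSolution H p δ ω y| ≤ ε) :
    Tendsto (fun δ : ℝ => ⨆ x : Metric.ball (0 : Space d) (R / δ),
      |c + δ * macroscopicSolution H p δ ω x|) (𝓝[>] 0) (𝓝 0) := by
  rw [Metric.tendsto_nhds]
  intro ε hε
  filter_upwards [hev (ε / 2) (by positivity), self_mem_nhdsWithin] with δ h hδ
  have hδ0 : (0 : ℝ) < δ := hδ
  rw [Real.dist_eq, sub_zero, abs_of_nonneg (Real.iSup_nonneg fun _ => abs_nonneg _)]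
  have : Nonempty (Metric.ball (0 : Space d) (R / δ)) :=
    ⟨⟨0, Metric.mem_ball_self (by positivity)⟩⟩
  have hsup : (⨆ x : Metric.ball (0 : Space d) (R / δ),
      |c + δ * macroscopicSolution H p δ ω x|) ≤ ε / 2 :=
    ciSup_le fun x => h x (mem_ball_zero_iff.1 x.2)
  linarith

theorem tendsto_neg_macroscopicSolution {d : ℕ} {Ω : Type*} {H : Space d → Space d → Ω → ℝ}
    {ω : Ω} {p : Space d} {c : ℝ}
    (hev : ∀ ε > 0, ∀ᶠ δ : ℝ in 𝓝[>] 0, ∀ y, ‖y‖ < 1 / δ →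
      |c + δ * macroscopicSolution H p δ ω y| ≤ ε) :
    Tendsto (fun δ : ℝ => -(δ * macroscopicSolution H p δ ω 0)) (𝓝[>] 0) (𝓝 c) := by
  rw [Metric.tendsto_nhds]
  intro ε hε
  filter_upwards [hev (ε / 2) (by positivity), self_mem_nhdsWithin] with δ h hδ
  have hδ0 : (0 : ℝ) < δ := hδ
  have h1 := h 0 (by rw [norm_zero]; positivity)
  rw [Real.dist_eq, ← abs_neg]
  refine lt_of_le_of_lt (le_of_eq ?_) (h1.trans_lt (half_lt_self hε))
  congr 1
  ring

namespace IsHamiltonian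

variable {d : ℕ} {Ω : Type*} [MeasurableSpace Ω] {P : Measure Ω} {τ : Space d → Ω → Ω}
  {H : Space d → Space d → Ω → ℝ}

/-- Convergence along a dense set of momenta and of directions is locally uniform in the
directions. -/
theorem eventually_abs_le_of_dense (hH : IsHamiltonian τ H) {ω : Ω} {h : Space d → ℝ}
    (hh : ∀ ρ, ∃ Λ, 0 ≤ Λ ∧ ∀ p p', ‖p‖ ≤ ρ → ‖p'‖ ≤ ρ → |h p - h p'| ≤ Λ * ‖p - p'‖)
    {a b : ℕ → Space d} (ha : DenseRange a) (hb : DenseRange b)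
    (hlim : ∀ i j, Tendsto (fun n : ℕ => (n : ℝ)⁻¹ *
      macroscopicSolution H (a i) (n : ℝ)⁻¹ ω ((n : ℝ) • b j)) atTop (𝓝 (-h (a i))))
    (p : Space d) (R : ℝ) {ε : ℝ} (hε : 0 < ε) :
    ∀ᶠ n : ℕ in atTop, ∀ x, ‖x‖ ≤ R →
      |h p + (n : ℝ)⁻¹ * macroscopicSolution H p (n : ℝ)⁻¹ ω ((n : ℝ) • x)| ≤ ε := by
  obtain ⟨C, K, Λ, hC, hK, hΛ, hbd, hlip, hp, -⟩ := hH.exists_estimates (‖p‖ + 1)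
  obtain ⟨Λ', hΛ', hhp⟩ := hh (‖p‖ + 1)
  -- Replacing `p` by `a i` costs `Λ * r` in the solution and `Λ' * r` in `h`; replacing `x` by `b
  -- j` costs `K * r`, the factors `n⁻¹` and `n` cancelling.
  obtain ⟨r, hr, hr1, hrε⟩ : ∃ r > 0, r ≤ 1 ∧ (Λ + Λ' + K) * r < ε / 2 := by
    have t : Tendsto (fun r : ℝ => (Λ + Λ' + K) * r) (𝓝[>] 0) (𝓝 ((Λ + Λ' + K) * 0)) :=
      (Continuous.tendsto (by fun_prop) 0).mono_left nhdsWithin_le_nhds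
    obtain ⟨r, h1, h2⟩ := ((t.eventually_lt_const (u := ε / 2) (by simpa using half_pos hε)).and
      (Ioc_mem_nhdsGT (zero_lt_one' ℝ))).exists
    exact ⟨r, h2.1, h2.2, h1⟩
  obtain ⟨i, hi⟩ := ha.exists_dist_lt p hr
  rw [dist_eq_norm] at hi
  have hai : ‖a i‖ ≤ ‖p‖ + 1 := by
    have := norm_sub_norm_le (a i) p
    rw [norm_sub_rev] at this
    linarith
  obtain ⟨t, ht⟩ := (isCompact_closedBall (0 : Space d) R).elim_finite_subcover
    (fun n => Metric.ball (b n) r) (fun _ => Metric.isOpen_ball) (fun z _ => by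
      obtain ⟨n, hn⟩ := hb.exists_dist_lt z hr
      exact mem_iUnion.2 ⟨n, hn⟩)
  have hev : ∀ᶠ n : ℕ in atTop, ∀ j ∈ t, |(n : ℝ)⁻¹ *
      macroscopicSolution H (a i) (n : ℝ)⁻¹ ω ((n : ℝ) • b j) - -h (a i)| < ε / 2 := by
    rw [Filter.eventually_all_finset]
    intro j _
    exact (Metric.tendsto_nhds.1 (hlim i j)) (ε / 2) (by positivity)
  filter_upwards [hev, eventually_gt_atTop 0] with n hn hn0 x hx
  have hn' : (0 : ℝ) < n := by exact_mod_cast hn0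
  have hni : 0 < (n : ℝ)⁻¹ := by positivity
  obtain ⟨j, hj, hxj⟩ : ∃ j ∈ t, x ∈ Metric.ball (b j) r := by
    have := ht (show x ∈ _ by simpa using hx)
    simpa using this
  rw [Metric.mem_ball, dist_eq_norm] at hxj
  have h1 := hn j hj
  have h2 := hp p (a i) (by linarith) hai _ hni ω ((n : ℝ) • x)
  have h3 := mul_le_mul_of_nonneg_left
    (hlip (a i) hai _ hni ω ((n : ℝ) • x) ((n : ℝ) • b j)) hni.le
  rw [← smul_sub, norm_smul, Real.norm_of_nonneg hn'.le,
    show (n : ℝ)⁻¹ * (K * (n * ‖x - b j‖)) = K * ‖x - b j‖ by field_simp] at h3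
  rw [← abs_of_pos hni, ← abs_mul, abs_of_pos hni, mul_sub] at h3
  have h4 := hhp p (a i) (by linarith) hai
  have h5 : Λ * ‖p - a i‖ ≤ Λ * r := by gcongr
  have h6 : Λ' * ‖p - a i‖ ≤ Λ' * r := by gcongr
  have h7 : K * ‖x - b j‖ ≤ K * r := by gcongr
  rw [abs_lt] at h1
  rw [abs_le] at h2 h3 h4 ⊢
  constructor <;> linarith

/-- From the discounts `1 / n` to all discounts. -/
theorem eventually_abs_le_of_natCast (hH : IsHamiltonian τ H) {ω : Ω} {p : Space d} {c R : ℝ}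
    (hR : 0 < R)
    (hev : ∀ ε > 0, ∀ᶠ n : ℕ in atTop, ∀ x, ‖x‖ ≤ 2 * R →
      |c + (n : ℝ)⁻¹ * macroscopicSolution H p (n : ℝ)⁻¹ ω ((n : ℝ) • x)| ≤ ε)
    {ε : ℝ} (hε : 0 < ε) :
    ∀ᶠ δ : ℝ in 𝓝[>] 0, ∀ y, ‖y‖ < R / δ → |c + δ * macroscopicSolution H p δ ω y| ≤ ε := by
  obtain ⟨C, K, Λ, hC, -, -, -, -, -, hδη⟩ := hH.exists_estimates ‖p‖
  have hfloor : Tendsto (fun δ : ℝ => ⌊δ⁻¹⌋₊) (𝓝[>] 0) atTop :=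
    tendsto_nat_floor_atTop.comp tendsto_inv_nhdsGT_zero
  have hsmall : ∀ᶠ δ : ℝ in 𝓝[>] 0, 2 * C * δ < ε / 2 := by
    have t : Tendsto (fun δ : ℝ => 2 * C * δ) (𝓝[>] 0) (𝓝 (2 * C * 0)) :=
      (Continuous.tendsto (by fun_prop) 0).mono_left nhdsWithin_le_nhds
    exact t.eventually_lt_const (by simpa using half_pos hε)
  filter_upwards [hfloor.eventually (hev (ε / 2) (by positivity)), hsmall,
    Ioc_mem_nhdsGT (show (0 : ℝ) < 1 / 2 by norm_num)] with δ h1 h2 hδ y hy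
  obtain ⟨hδ0, hδ2⟩ := hδ
  -- Then `|m * δ - 1| ≤ δ`, so passing from `δ` to `1 / m` costs at most `2 * C * δ`. As `δ ≤ 1 /
  -- 2` gives `m * δ > 1 / 2`, the point `y / m` has norm at most `2 * R`, which is why `hev` uses
  -- the doubled radius.
  set m := ⌊δ⁻¹⌋₊ with hm
  have hm1 : (m : ℝ) ≤ δ⁻¹ := Nat.floor_le (by positivity)
  have hm2 : δ⁻¹ < m + 1 := Nat.lt_floor_add_one _
  have hmδ1 : m * δ ≤ 1 := by
    have := mul_le_mul_of_nonneg_right hm1 hδ0.le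
    rwa [inv_mul_cancel₀ hδ0.ne'] at this
  have hmδ2 : 1 < m * δ + δ := by
    have := mul_lt_mul_of_pos_right hm2 hδ0
    rw [inv_mul_cancel₀ hδ0.ne'] at this
    linarith
  have hm0 : (0 : ℝ) < m := by
    by_contra! h
    nlinarith
  have h3 := h1 ((m : ℝ)⁻¹ • y) (by
    rw [norm_smul, Real.norm_of_nonneg (by positivity), inv_mul_le_iff₀ hm0]
    rw [lt_div_iff₀ hδ0] at hy
    nlinarith [norm_nonneg y])
  rw [smul_inv_smul₀ hm0.ne'] at h3
  have h4 := hδη p le_rfl δ (m : ℝ)⁻¹ hδ0 (by positivity) ω y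
  have h5 : 2 * C * |δ - (m : ℝ)⁻¹| / (m : ℝ)⁻¹ ≤ 2 * C * δ := by
    rw [div_inv_eq_mul, mul_assoc]
    gcongr
    have e : |δ - (m : ℝ)⁻¹| * m = |m * δ - 1| := by
      rw [← abs_of_pos hm0, ← abs_mul, abs_of_pos hm0]
      congr 1
      field_simp
    rw [e, abs_le]
    constructor <;> linarith
  rw [abs_le] at h3 h4 ⊢
  constructor <;> linarith

/-- Deterministic limits are locally Lipschitz continuous in the momentum. -/
theorem exists_lipschitz_of_ae_tendsto [IsProbabilityMeasure P] (hH : IsHamiltonian τ H)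
    {h : Space d → ℝ} (hlim : ∀ p, ∀ᵐ ω ∂P,
      Tendsto (fun δ : ℝ => -(δ * macroscopicSolution H p δ ω 0)) (𝓝[>] 0) (𝓝 (h p))) (ρ : ℝ) :
    ∃ Λ, 0 ≤ Λ ∧ ∀ p p', ‖p‖ ≤ ρ → ‖p'‖ ≤ ρ → |h p - h p'| ≤ Λ * ‖p - p'‖ := by
  obtain ⟨C, K, Λ, -, -, hΛ, -, -, hp, -⟩ := hH.exists_estimates ρ
  refine ⟨Λ, hΛ, fun p p' h1 h2 => ?_⟩
  obtain ⟨ω, h3, h4⟩ := ((hlim p).and (hlim p')).exists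
  refine le_of_tendsto (h3.sub h4).abs ?_
  filter_upwards [self_mem_nhdsWithin] with δ hδ
  rw [neg_sub_neg, abs_sub_comm]
  exact hp p p' h1 h2 δ hδ ω 0

end IsHamiltonian

/-! ### Conclusion -/

theorem proposition9p2 {d : ℕ} {Ω : Type*} [MeasurableSpace Ω] (P : Measure Ω)
    [IsProbabilityMeasure P] (τ : Space d → Ω → Ω) (hτ : IsErgodicGroup P τ)
    (hloc : ∀ H' : Space d → Space d → Ω → ℝ, IsHamiltonian τ H' → IsConvexOutsideBall τ H' →
      ∀ᵐ ω ∂P, ∀ p : Space d, ∃ L : ℝ,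
        Tendsto (fun δ : ℝ => -(δ * macroscopicSolution H' p δ ω 0)) (𝓝[>] 0) (𝓝 L))
    (H : Space d → Space d → Ω → ℝ) (hH : IsHamiltonian τ H) :
    (∀ (p : Space d) (δ : ℝ) (ω : Ω), 0 < δ →
      ∃! v, IsMacroscopicSolution (fun q y => H q y ω) p δ v) ∧
    ∀ᵐ ω ∂P, ∀ p : Space d,
      randomEffectiveHamiltonian H p ω = effectiveHamiltonian P H p ∧
      ∀ R : ℝ, 0 < R →
        Tendsto (fun δ : ℝ => ⨆ x : Metric.ball (0 : Space d) (R / δ),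
          |effectiveHamiltonian P H p + δ * macroscopicSolution H p δ ω x|) (𝓝[>] 0) (𝓝 0) := by
  refine ⟨fun p δ ω hδ => hH.existsUnique_isMacroscopicSolution p hδ ω, ?_⟩
  have hex := hH.ae_exists_tendsto hloc
  have hlim : ∀ p, ∀ᵐ ω ∂P, Tendsto (fun δ : ℝ => -(δ * macroscopicSolution H p δ ω 0)) (𝓝[>] 0)
      (𝓝 (effectiveHamiltonian P H p)) := by
    intro p
    obtain ⟨c, hc⟩ := hH.exists_ae_tendsto_const hτ (p := p) (hex.mono fun ω hω => hω p)
    rwa [IsHamiltonian.effectiveHamiltonian_eq hc]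
  have hdense : DenseRange (TopologicalSpace.denseSeq (Space d)) :=
    TopologicalSpace.denseRange_denseSeq _
  -- `hlim` has a null set depending on `p`; only countably many momenta and directions enter the
  -- common event, and on it the limit at the origin for every `p` is recovered from the convergence
  -- on balls.
  have hall := ae_all_iff.2 fun i => ae_all_iff.2 fun j => hH.ae_tendsto_along_direction hτ
    (hlim (TopologicalSpace.denseSeq (Space d) i)) (TopologicalSpace.denseSeq (Space d) j)
  filter_upwards [hall] with ω hω p
  have hev : ∀ R : ℝ, 0 < R → ∀ ε > 0, ∀ᶠ δ : ℝ in 𝓝[>] 0, ∀ y, ‖y‖ < R / δ →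
      |effectiveHamiltonian P H p + δ * macroscopicSolution H p δ ω y| ≤ ε := fun R hR ε hε =>
    hH.eventually_abs_le_of_natCast hR (fun η hη => hH.eventually_abs_le_of_dense
      (hH.exists_lipschitz_of_ae_tendsto hlim) hdense hdense hω p (2 * R) hη) hε
  exact ⟨(tendsto_neg_macroscopicSolution (hev 1 one_pos)).limsup_eq,
    fun R hR => tendsto_iSup_abs_macroscopicSolution hR (hev R hR)⟩
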